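/- Let $f$ be a real, statistically homogeneous random field with zero mean and finite moments of all orders on $\mathbb R^d$, considered in periodic boxes with side lengths $L_1,\dots,L_d$ and volume $V=L_1\cdots L_d\to\infty$ (for each box there is one such periodic field). Put $$f_{\mathbf k}=V^{-1/2}\int_{\rm box} f(\mathbf x)e^{-i\mathbf k\cdot\mathbf x}\,d^dx .$$ Let $\langle\cdots\rangle_{\rm c}$ denote joint cumulants, and let the polyspectra $P^{(N)}$ be defined by $$\langle f_{\mathbf k_1}\cdots f_{\mathbf k_N}\rangle_{\rm c}=V^{1-N/2}P^{(N)}(\mathbf k_1,\dots,\mathbf k_N).$$ Write $P(\mathbf k)=P^{(2)}(\mathbf k,-\mathbf k)$ and $$p^{(N)}(\mathbf k_1,\dots,\mathbf k_N)=\delta_{\mathbf k_1+\cdots+\mathbf k_N,\mathbf 0}\,\frac{P^{(N)}(\mathbf k_1,\dots,\mathbf k_N)}{\sqrt{P(\mathbf k_1)\cdots P(\mathbf k_N)}} .$$ Let $n,m$ be coprime positive integers and let $\mathbf k_1\ne\mathbf k_2$ be non-zero wavevectors, common to all the boxes, with $n\mathbf k_1=m\mathbf k_2$ and $P(\mathbf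 k_1),P(\mathbf k_2)>0$. Suppose that for all arguments among $\pm\mathbf k_1,\pm\mathbf k_2$ the polyspectra do not depend on the box and satisfy $P^{(N)}(-\mathbf k_1',\dots,-\mathbf k_N')=P^{(N)}(\mathbf k_1',\dots,\mathbf k_N')$. Write $\alpha_s=f_{\mathbf k_s}/\sqrt{P(\mathbf k_s)}=a_s+ib_s=A_se^{i\theta_s}$ for $s=1,2$. The distribution function of the two modes is expanded in powers of $V^{-1/2}$ as $$\mathcal P(\alpha_1,\alpha_2)=\int\prod_{s=1}^2\frac{dK_s\,dL_s}{(2\pi)^2}\;e^{iX}\exp\Bigl(\sum_{N\ge2}\frac{(-i)^N}{N!}\langle X^N\rangle_{\rm c}\Bigr)=\sum_{j\ge0}V^{-j/2}q_j(\alpha_1,\alpha_2),\qquad X=\sum_{s=1}^2(K_sa_s+L_sb_s).$$ Here the cumulant of order $N\ge3$ has order $V^{-(N-2)/2}$, the $N=2$ term is kept in the exponent, the exponential of the remaining terms is expanded as a formal series in $V^{-1/2}$, and the integral is taken term by term. Let $$C_2(\theta_1,\theta_2)=(2\pi)^2\int_0^\infty\!\!\int_0^\infty \mathcal P\,A_1A_2\,dA_1dA_2-1$$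 be the reduced two-point phase correlation, expanded correspondingly in $V^{-1/2}$. Then $$C_2(\theta_1,\theta_2)=\frac{2V^{(2-n-m)/2}}{n!\,m!}\,\Gamma\!\left(1+\tfrac n2\right)\Gamma\!\left(1+\tfrac m2\right)\cos(n\theta_1-m\theta_2)\;p^{(n+m)}(\underbrace{\mathbf k_1,\dots,\mathbf k_1}_{n},\underbrace{-\mathbf k_2,\dots,-\mathbf k_2}_{m})+O\!\left(V^{(1-n-m)/2}\right)$$ in the following senses. 1. As formal power series in $V^{-1/2}$: the two sides agree up to terms of order $(V^{-1/2})^{n+m-1}$ and higher. 2. For every $J\ge n+m-2$, the partial sum of the series $C_2$ through the power $V^{-J/2}$ equals the displayed main term up to an error at most $K\,V^{(1-n-m)/2}$ as $V\to\infty$, with $K$ independent of $V,\theta_1,\theta_2$. 3. Suppose that $(\alpha_1,\alpha_2)$ has an actual joint density $\rho_V$ with respect to $da_1\,db_1\,da_2\,db_2$, and that for large $V$ and all $z=(z_1,z_2)\in\mathbb C^2$ $$\Bigl|\rho_V(z)-\sum_{j\le n+m-2}V^{-j/2}q_j(z)\Bigr|\le K'\,V^{(1-n-m)/2}(1+|z|)^{-5},\qquad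 |z|=\max(|z_1|,|z_2|),$$ with a constant $K'$. Then the actual correlation $(2\pi)^2\int_0^\infty\!\int_0^\infty\rho_V A_1A_2\,dA_1dA_2-1$ equals the main term up to $O(V^{(1-n-m)/2})$, uniformly in $\theta_1,\theta_2$. -/

import Mathlib

open MeasureTheory ProbabilityTheory Filter Topology
open scoped BigOperators Nat

noncomputable section

namespace FourierPhase

/-! ### Random fields in a periodic box -/

/-- The fundamental cell `∏ⱼ [0, Lⱼ)` of the periodic box with side lengths `L`. -/
def box {d : ℕ} (L : Fin d → ℝ) : Set (Fin d → ℝ) :=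
  Set.univ.pi fun j => Set.Ico 0 (L j)

/-- The volume `V = L₁ ⋯ L_d`. -/
def vol {d : ℕ} (L : Fin d → ℝ) : ℝ := ∏ j, L j

/-- `k` is a wavevector of the box: `kⱼ` is an integer multiple of `2π / Lⱼ`. -/
def IsWavevector {d : ℕ} (L k : Fin d → ℝ) : Prop :=
  ∀ j, ∃ z : ℤ, k j = 2 * Real.pi * z / L j

/-- A real, statistically homogeneous random field with zero mean and finite moments of all
orders in the periodic box with sides `L`, realised as a periodic function on `ℝ^d`. -/
structure IsHomogeneousField {d : ℕ} {Ω : Type*} [MeasurableSpace Ω] (μ : Measure Ω)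
    (L : Fin d → ℝ) (f : Ω → (Fin d → ℝ) → ℝ) : Prop where
  measurable : Measurable (Function.uncurry f)
  periodic : ∀ ω x j, f ω (x + Pi.single j (L j)) = f ω x
  moments : ∀ N : ℕ,
    Integrable (fun z : Ω × (Fin d → ℝ) => |f z.1 z.2| ^ N) (μ.prod (volume.restrict (box L)))
  zero_mean : ∀ x, ∫ ω, f ω x ∂μ = 0
  /-- All finite-dimensional distributions are translation invariant. -/
  homogeneous : ∀ (a : Fin d → ℝ) (N : ℕ) (x : Fin N → Fin d → ℝ),
    IdentDistrib (fun ω j => f ω (x j + a)) (fun ω j => f ω (x j)) μ μ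

/-- The volume-normalized Fourier coefficient
`f_k = V^{-1/2} ∫_box f(x) e^{-i k·x} dx`. -/
def mode {d : ℕ} {Ω : Type*} (L : Fin d → ℝ) (f : Ω → (Fin d → ℝ) → ℝ)
    (k : Fin d → ℝ) (ω : Ω) : ℂ :=
  (∫ x in box L, (f ω x : ℂ) * Complex.exp (-Complex.I * ((∑ j, k j * x j : ℝ) : ℂ)))
    / (Real.sqrt (vol L) : ℂ)

/-! ### Cumulants and polyspectra -/

/-- The joint cumulant `⟨X₁ ⋯ X_N⟩_c`, as a sum over the set partitions of `{1, …, N}`. -/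
def jointCumulant {Ω : Type*} [MeasurableSpace Ω] (μ : Measure Ω) {N : ℕ}
    (X : Fin N → Ω → ℂ) : ℂ :=
  ∑ π : Finpartition (Finset.univ : Finset (Fin N)),
    (-1) ^ (π.parts.card - 1) * ((π.parts.card - 1)! : ℂ) *
      ∏ B ∈ π.parts, ∫ ω, ∏ j ∈ B, X j ω ∂μ

/-- The polyspectrum of a field in the box `L`, so that
`⟨f_{k₁} ⋯ f_{k_N}⟩_c = V^{1 - N/2} P^{(N)}(k₁, …, k_N)`; all `N` wavevectors are arguments. -/
def polyspectrum {d : ℕ} {Ω : Type*} [MeasurableSpace Ω] (μ : Measure Ω) (L : Fin d → ℝ)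
    (f : Ω → (Fin d → ℝ) → ℝ) (N : ℕ) (k : Fin N → Fin d → ℝ) : ℂ :=
  ((vol L ^ ((N : ℝ) / 2 - 1) : ℝ) : ℂ) * jointCumulant μ fun j => mode L f (k j)

/-- A hierarchy of polyspectra: a function of `N` wavevectors for every `N`. -/
abbrev Polyspectra (d : ℕ) : Type := (N : ℕ) → (Fin N → Fin d → ℝ) → ℂ

/-- The power spectrum `P(k) = P^{(2)}(k, -k)`. -/
def powerSpectrum {d : ℕ} (P : Polyspectra d) (k : Fin d → ℝ) : ℝ := (P 2 ![k, -k]).re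

open Classical in
/-- The normalized polyspectrum
`p^{(N)}(k₁, …, k_N) = δ_{k₁ + ⋯ + k_N, 0} P^{(N)} / √(P(k₁) ⋯ P(k_N))`. -/
def normPolyspectrum {d : ℕ} (P : Polyspectra d) (N : ℕ) (k : Fin N → Fin d → ℝ) : ℂ :=
  if ∑ j, k j = 0 then P N k / (Real.sqrt (∏ j, powerSpectrum P (k j)) : ℂ) else 0

/-- All the wavevectors of the tuple `k` are among `k₁, -k₁, k₂, -k₂`. -/
def FromModes {d : ℕ} (k₁ k₂ : Fin d → ℝ) {N : ℕ} (k : Fin N → Fin d → ℝ) : Prop :=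
  ∀ j, k j = k₁ ∨ k j = -k₁ ∨ k j = k₂ ∨ k j = -k₂

/-- The normalized Fourier coefficient `α_k = f_k / √P(k)`. -/
def alpha {d : ℕ} {Ω : Type*} (P : Polyspectra d) (L : Fin d → ℝ)
    (f : Ω → (Fin d → ℝ) → ℝ) (k : Fin d → ℝ) (ω : Ω) : ℂ :=
  mode L f k ω / (Real.sqrt (powerSpectrum P k) : ℂ)

/-! ### Expansion of the two-mode distribution function in powers of `V^{-1/2}`

In this part `Y = (α₁, α₂)` is a pair of complex random variables and `V` a volume. -/

/-- `X = K₁ a₁ + L₁ b₁ + K₂ a₂ + L₂ b₂` for `α_s = a_s + i b_s` and `w_s = K_s + i L_s`. -/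
def pairing (w z : ℂ × ℂ) : ℝ :=
  w.1.re * z.1.re + w.1.im * z.1.im + (w.2.re * z.2.re + w.2.im * z.2.im)

/-- The cumulant `⟨X^N⟩_c` of the random variable `X = pairing w Y`. -/
def cumulantX {Ω : Type*} [MeasurableSpace Ω] (μ : Measure Ω) (Y : Ω → ℂ × ℂ)
    (N : ℕ) (w : ℂ × ℂ) : ℂ :=
  jointCumulant μ fun (_ : Fin N) ω => (pairing w (Y ω) : ℂ)

/-- The non-Gaussian part `∑_{N ≥ 3} (-i)^N / N! ⟨X^N⟩_c` of `log ⟨e^{-iX}⟩` as a formal power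
series in `ε = V^{-1/2}`, where `⟨X^N⟩_c = ε^{N-2} (V^{(N-2)/2} ⟨X^N⟩_c)` has order `N - 2`. -/
def exponentSeries {Ω : Type*} [MeasurableSpace Ω] (μ : Measure Ω) (V : ℝ) (Y : Ω → ℂ × ℂ)
    (w : ℂ × ℂ) : PowerSeries ℂ :=
  PowerSeries.mk fun r =>
    if r = 0 then 0
    else (-Complex.I) ^ (r + 2) / ((r + 2)! : ℂ) *
      (((V ^ ((r : ℝ) / 2) : ℝ) : ℂ) * cumulantX μ Y (r + 2) w)

/-- The coefficient of `ε^j` in the exponential of `exponentSeries`; its constant term is `0`, so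
only the powers up to the `j`-th contribute. -/
def expCoeff {Ω : Type*} [MeasurableSpace Ω] (μ : Measure Ω) (V : ℝ) (Y : Ω → ℂ × ℂ)
    (j : ℕ) (w : ℂ × ℂ) : ℂ :=
  ∑ s ∈ Finset.range (j + 1),
    ((s ! : ℂ))⁻¹ * PowerSeries.coeff j (exponentSeries μ V Y w ^ s)

/-- The coefficient of `V^{-j/2}` in the distribution function
`𝒫(z) = ∫ dK₁ dL₁ dK₂ dL₂ / (2π)^4 · e^{iX} exp(∑_N (-i)^N / N! ⟨X^N⟩_c)` of `Y`
with respect to Lebesgue measure `da₁ db₁ da₂ db₂`: the inverse Fourier transform is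
taken term by term, the quadratic cumulant being kept in the exponent. -/
def densityCoeff {Ω : Type*} [MeasurableSpace Ω] (μ : Measure Ω) (V : ℝ) (Y : Ω → ℂ × ℂ)
    (j : ℕ) (z : ℂ × ℂ) : ℂ :=
  (((2 * Real.pi) ^ 4 : ℝ) : ℂ)⁻¹ *
    ∫ w : ℂ × ℂ, Complex.exp (Complex.I * (pairing w z : ℂ)) *
      (Complex.exp (-(cumulantX μ Y 2 w) / 2) * expCoeff μ V Y j w)

/-- The point with moduli `A` and phases `θ`. -/
def polar (A θ : ℝ × ℝ) : ℂ × ℂ :=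
  (A.1 * Complex.exp (Complex.I * θ.1), A.2 * Complex.exp (Complex.I * θ.2))

/-- Integration of a function of two complex variables over both moduli, with the Jacobian
`A₁ A₂` of polar coordinates. For a density this gives the distribution of the phases. -/
def integrateModuli {E : Type*} [NormedAddCommGroup E] [NormedSpace ℝ E]
    (q : ℂ × ℂ → E) (θ : ℝ × ℝ) : E :=
  ∫ A in Set.Ioi (0 : ℝ) ×ˢ Set.Ioi (0 : ℝ), (A.1 * A.2) • q (polar A θ)

/-- The reduced two-point phase correlation `C₂ = (2π)² P₂(θ₁, θ₂) - 1` as a formal power series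
in `ε = V^{-1/2}`. -/
def corrSeries {Ω : Type*} [MeasurableSpace Ω] (μ : Measure Ω) (V : ℝ) (Y : Ω → ℂ × ℂ)
    (θ : ℝ × ℝ) : PowerSeries ℂ :=
  (PowerSeries.mk fun j =>
    (((2 * Real.pi) ^ 2 : ℝ) : ℂ) * integrateModuli (densityCoeff μ V Y j) θ) - 1

/-- The reduced two-point phase correlation `C₂ = (2π)² P₂(θ₁, θ₂) - 1` for the actual joint
density `ρ` of `(α₁, α₂)`. -/
def corr (ρ : ℂ × ℂ → ℝ) (θ : ℝ × ℝ) : ℝ :=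
  (2 * Real.pi) ^ 2 * integrateModuli ρ θ - 1

/-- `ρ` is a joint probability density of `Y = (α₁, α₂)`. -/
structure IsJointDensity {Ω : Type*} [MeasurableSpace Ω] (μ : Measure Ω) (Y : Ω → ℂ × ℂ)
    (ρ : ℂ × ℂ → ℝ) : Prop where
  measurable : Measurable ρ
  nonneg : ∀ z, 0 ≤ ρ z
  map_eq : μ.map Y = volume.withDensity fun z => ENNReal.ofReal (ρ z)

/-- The coefficient
`2 / (n! m!) Γ(1 + n/2) Γ(1 + m/2) cos(n θ₁ - m θ₂) p^{(n+m)}(k₁, …, k₁, -k₂, …, -k₂)`,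
with `k₁` repeated `n` times and `-k₂` repeated `m` times. -/
def leading {d : ℕ} (P : Polyspectra d) (k₁ k₂ : Fin d → ℝ) (n m : ℕ) (θ : ℝ × ℝ) : ℂ :=
  ((2 / ((n ! : ℝ) * (m ! : ℝ)) * Real.Gamma (1 + (n : ℝ) / 2) * Real.Gamma (1 + (m : ℝ) / 2) *
      Real.cos (n * θ.1 - m * θ.2) : ℝ) : ℂ) *
    normPolyspectrum P (n + m) (Fin.append (fun _ : Fin n => k₁) (fun _ : Fin m => -k₂))

end FourierPhase

end

open FourierPhase

noncomputable section

namespace FourierPhase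

open ComplexConjugate

/-! ### Gaussian integrals over the complex plane -/

/-! The argument takes place in Fourier space. With `w_s = K_s + i L_s`, the variable `X` is a
linear form in the four amplitudes `α₁, ᾱ₁, α₂, ᾱ₂`, so multilinearity of cumulants
(`jointCumulant_sum_mul`) turns the scaled cumulant of order `N` into a homogeneous polynomial in
`w_s/2` and `w̄_s/2`. Its coefficients are the normalized polyspectra of `N`-tuples taken from `±k₁,
±k₂` (`vol_mul_cumulantX`). Translation invariance kills every tuple whose wavevectors do not add up
to zero (`jointCumulant_mode_eq_zero`).

Since `n` and `m` are coprime, a zero-sum tuple has excess `t n` of `k₁` over `-k₁` and excess `-t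
m` of `k₂` over `-k₂` for some integer `t` (`Resonance.exists_int`). If `N < n + m`, then `t = 0`,
and the monomial is a product of the intensities `|w_s|²`. If `N = n + m`, the only other tuples are
those with exactly `n` entries `k₁` and `m` entries `-k₂`, and their reflections
(`Resonance.mult_cases`). As `n + m > 2`, the quadratic part is the standard Gaussian with
independent modes.

A product of intensities times the Gaussian has a radial inverse transform. Its integral over the
moduli is therefore proportional to the integral over both planes, that is, to the Fourier-side
value at `w = 0`; only the constant term survives (`radialMoment_self`,
`phaseFunctional_of_mem_range`). In the exponential, every product of two or more cumulant terms of
total order at most `n + m - 2` has factors of strictly lower order, which are polynomials in the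
intensities (`Resonance.coeff_pow_mem_range`). Hence all coefficients of `C₂` below order `n + m -
2` vanish, and the coefficient at this order comes from the linear term alone.

Each of the two resonant families has `(n+m).choose n` members, which turns `1/(n+m)!` into `1/(n!
m!)`. The moduli integrals of `w̄₁ⁿ w₂ᵐ` and of its conjugate give the Gamma factors and opposite
phases, hence the cosine (`radialMoment_resonant`). The later coefficients are bounded uniformly in
the phases and do not involve the box, which controls the partial sums. For an actual density, the
assumed pointwise error is integrated against `A₁ A₂` (`norm_corr_sub_le`). -/

lemma integrable_exp_neg_sq_norm {b : ℝ} (hb : 0 < b) :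
    Integrable fun w : ℂ => Real.exp (-b * ‖w‖ ^ 2) := by
  have h := (GaussianFourier.integrable_cexp_neg_mul_sq_norm_add (V := ℂ) (b := (b : ℂ))
    (by simpa using hb) 0 0).norm
  refine h.congr (ae_of_all _ fun w => ?_)
  simp only [zero_mul, add_zero, Complex.norm_exp]
  congr 1
  norm_cast

lemma integrable_exp_mul_gaussian_mul_pow (K : ℝ) (N : ℕ) :
    Integrable fun w : ℂ => Real.exp (K * ‖w‖) * (Real.exp (-‖w‖ ^ 2 / 4) * ‖w‖ ^ N) := by
  refine ((integrable_exp_neg_sq_norm (b := 1 / 8) (by norm_num)).const_mul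
    (Real.exp (2 * (K + 1) ^ 2) * N !)).mono' (by fun_prop) (ae_of_all _ fun w => ?_)
  rw [Real.norm_of_nonneg (by positivity)]
  have h1 : ‖w‖ ^ N ≤ N ! * Real.exp ‖w‖ := by
    have := Real.pow_div_factorial_le_exp ‖w‖ (norm_nonneg _) N
    rwa [div_le_iff₀' (by positivity)] at this
  calc Real.exp (K * ‖w‖) * (Real.exp (-‖w‖ ^ 2 / 4) * ‖w‖ ^ N)
      ≤ Real.exp (K * ‖w‖) * (Real.exp (-‖w‖ ^ 2 / 4) * (N ! * Real.exp ‖w‖)) := by gcongr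
    _ = N ! * Real.exp (K * ‖w‖ + -‖w‖ ^ 2 / 4 + ‖w‖) := by
        rw [Real.exp_add, Real.exp_add]; ring
    -- Half of the Gaussian exponent absorbs the linear terms: the difference of the two exponents
    -- is `(‖w‖ - 4 (K + 1))² / 8`.
    _ ≤ N ! * Real.exp (2 * (K + 1) ^ 2 + -(1 / 8) * ‖w‖ ^ 2) := by
        refine mul_le_mul_of_nonneg_left (Real.exp_le_exp.2 ?_) (by positivity)
        nlinarith [sq_nonneg (‖w‖ - 4 * (K + 1))]
    _ = _ := by rw [Real.exp_add]; ring

/-- The Gaussian weight times the monomial `(w̄ / 2) ^ p * (w / 2) ^ q`. -/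
def gaussMonomial (p q : ℕ) (w : ℂ) : ℂ :=
  Complex.exp (-(‖w‖ : ℂ) ^ 2 / 4) * ((conj w / 2) ^ p * (w / 2) ^ q)

lemma continuous_gaussMonomial (p q : ℕ) : Continuous (gaussMonomial p q) := by
  unfold gaussMonomial; fun_prop

lemma norm_gaussMonomial_le (p q : ℕ) (w : ℂ) :
    ‖gaussMonomial p q w‖ ≤ Real.exp (-‖w‖ ^ 2 / 4) * ‖w‖ ^ (p + q) := by
  have h : (-(‖w‖ : ℂ) ^ 2 / 4).re = -‖w‖ ^ 2 / 4 := by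
    rw [← Complex.ofReal_re (-‖w‖ ^ 2 / 4)]; congr 1; push_cast; rfl
  rw [gaussMonomial, norm_mul, norm_mul, Complex.norm_exp, norm_pow, norm_pow, norm_div, norm_div,
    RCLike.norm_conj, Complex.norm_two, ← pow_add, h]
  gcongr
  linarith [norm_nonneg w]

/-- The integral of a Gaussian monomial against `exp (i (w̄ ζ + w η) / 2)`. -/
def gaussInt (p q : ℕ) (ζ η : ℂ) : ℂ :=
  ∫ w : ℂ, Complex.exp (ζ * (Complex.I * (conj w / 2)) + η * (Complex.I * (w / 2))) *
    gaussMonomial p q w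

lemma norm_exp_mul_add_le (a b ζ η w : ℂ) (ha : ‖a‖ ≤ ‖w‖) (hb : ‖b‖ ≤ ‖w‖) :
    ‖Complex.exp (ζ * a + η * b)‖ ≤ Real.exp ((‖ζ‖ + ‖η‖) * ‖w‖) := by
  rw [Complex.norm_exp]
  refine Real.exp_le_exp.2 ((Complex.re_le_norm _).trans ((norm_add_le _ _).trans ?_))
  rw [norm_mul, norm_mul, add_mul]
  gcongr

lemma norm_I_mul_half_le (w : ℂ) : ‖Complex.I * (w / 2)‖ ≤ ‖w‖ := by
  simp only [norm_mul, Complex.norm_I, norm_div, Complex.norm_two]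
  linarith [norm_nonneg w]

lemma norm_I_mul_half_conj_le (w : ℂ) : ‖Complex.I * (conj w / 2)‖ ≤ ‖w‖ := by
  simpa only [RCLike.norm_conj] using norm_I_mul_half_le (conj w)

lemma integrable_gaussInt_aux (p q : ℕ) (a b : ℂ → ℂ) (ha : Continuous a) (hb : Continuous b)
    (ha' : ∀ w, ‖a w‖ ≤ ‖w‖) (hb' : ∀ w, ‖b w‖ ≤ ‖w‖) (ζ η : ℂ) :
    Integrable fun w : ℂ => Complex.exp (ζ * a w + η * b w) * gaussMonomial p q w := by
  refine (integrable_exp_mul_gaussian_mul_pow (‖ζ‖ + ‖η‖) (p + q)).mono'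
    (by have := continuous_gaussMonomial p q; fun_prop) (ae_of_all _ fun w => ?_)
  rw [norm_mul]
  gcongr
  · exact norm_exp_mul_add_le _ _ _ _ _ (ha' w) (hb' w)
  · exact norm_gaussMonomial_le p q w

/-- Differentiation under the integral sign, dominated on the unit ball around `ζ`. The linear forms
`a`, `b` are left general so that exchanging their roles covers the derivative in either parameter.
-/
lemma hasDerivAt_gaussInt_aux (p q : ℕ) (a b : ℂ → ℂ) (ha : Continuous a) (hb : Continuous b)
    (ha' : ∀ w, ‖a w‖ ≤ ‖w‖) (hb' : ∀ w, ‖b w‖ ≤ ‖w‖) (ζ η : ℂ) :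
    HasDerivAt (fun ζ => ∫ w : ℂ, Complex.exp (ζ * a w + η * b w) * gaussMonomial p q w)
      (∫ w : ℂ, Complex.exp (ζ * a w + η * b w) * (a w * gaussMonomial p q w)) ζ := by
  have hc := continuous_gaussMonomial p q
  refine (hasDerivAt_integral_of_dominated_loc_of_deriv_le (Metric.ball_mem_nhds ζ one_pos)
    (Eventually.of_forall fun ζ => ?_) (integrable_gaussInt_aux p q a b ha hb ha' hb' ζ η)
    (F' := fun ζ w => Complex.exp (ζ * a w + η * b w) * (a w * gaussMonomial p q w))
    ?_ (ae_of_all _ fun w ξ hξ => ?_)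
    (integrable_exp_mul_gaussian_mul_pow (‖ζ‖ + 1 + ‖η‖) (p + q + 1))
    (ae_of_all _ fun w ξ hξ => ?_)).2
  · fun_prop
  · fun_prop
  · rw [norm_mul, norm_mul]
    have h1 : ‖ξ‖ ≤ ‖ζ‖ + 1 := by
      have := norm_le_norm_add_norm_sub' ξ ζ
      rw [Metric.mem_ball, dist_eq_norm] at hξ
      linarith
    calc ‖Complex.exp (ξ * a w + η * b w)‖ * (‖a w‖ * ‖gaussMonomial p q w‖)
        ≤ Real.exp ((‖ζ‖ + 1 + ‖η‖) * ‖w‖) *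
          (‖w‖ * (Real.exp (-‖w‖ ^ 2 / 4) * ‖w‖ ^ (p + q))) := by
          gcongr
          · exact (norm_exp_mul_add_le _ _ _ _ _ (ha' w) (hb' w)).trans (by gcongr)
          · exact ha' w
          · exact norm_gaussMonomial_le p q w
      _ = _ := by ring
  · have h : HasDerivAt (fun ξ : ℂ => ξ * a w + η * b w) (a w) ξ := by
      simpa using ((hasDerivAt_id ξ).mul_const (a w)).add_const (η * b w)
    exact (h.cexp.mul_const (gaussMonomial p q w)).congr_deriv (by ring)

lemma hasDerivAt_gaussInt_left (p q : ℕ) (ζ η : ℂ) :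
    HasDerivAt (fun ζ => gaussInt p q ζ η) (Complex.I * gaussInt (p + 1) q ζ η) ζ := by
  refine (hasDerivAt_gaussInt_aux p q (fun w => Complex.I * (conj w / 2))
    (fun w => Complex.I * (w / 2)) (by fun_prop) (by fun_prop) norm_I_mul_half_conj_le
    norm_I_mul_half_le ζ η).congr_deriv ?_
  rw [gaussInt, ← integral_const_mul]
  congr 1; ext w; rw [gaussMonomial, gaussMonomial, pow_succ]; ring

lemma hasDerivAt_gaussInt_right (p q : ℕ) (ζ η : ℂ) :
    HasDerivAt (fun η => gaussInt p q ζ η) (Complex.I * gaussInt p (q + 1) ζ η) η := by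
  have := hasDerivAt_gaussInt_aux p q (fun w => Complex.I * (w / 2))
    (fun w => Complex.I * (conj w / 2)) (by fun_prop) (by fun_prop) norm_I_mul_half_le
    norm_I_mul_half_conj_le η ζ
  simp only [add_comm (_ * (Complex.I * (_ / 2))) (ζ * _)] at this
  refine HasDerivAt.congr_deriv this ?_
  rw [gaussInt, ← integral_const_mul]
  congr 1; ext w; rw [gaussMonomial, gaussMonomial, pow_succ]; ring

/-- In real coordinates the integrand splits into two one-dimensional complex Gaussians. Keeping `ζ`
and `η` independent, instead of conjugate, makes the result holomorphic in each, so that all other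
`gaussInt` follow by differentiation. -/
lemma gaussInt_zero_zero (ζ η : ℂ) :
    gaussInt 0 0 ζ η = 4 * Real.pi * Complex.exp (-(ζ * η)) := by
  rw [gaussInt, ← (Complex.volume_preserving_equiv_real_prod.symm).integral_comp
    (Complex.measurableEquivRealProd.symm.measurableEmbedding), Measure.volume_eq_prod]
  have h : ∀ z : ℝ × ℝ, Complex.exp
      (ζ * (Complex.I * (conj (Complex.measurableEquivRealProd.symm z) / 2)) +
        η * (Complex.I * (Complex.measurableEquivRealProd.symm z / 2))) *
      gaussMonomial 0 0 (Complex.measurableEquivRealProd.symm z) =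
      Complex.exp (-(1 / 4) * z.1 ^ 2 + (Complex.I * (ζ + η) / 2) * z.1 + 0) *
      Complex.exp (-(1 / 4) * z.2 ^ 2 + ((ζ - η) / 2) * z.2 + 0) := by
    rintro ⟨x, y⟩
    have h1 : Complex.measurableEquivRealProd.symm (x, y) = x + y * Complex.I := by
      apply Complex.ext <;> simp [Complex.measurableEquivRealProd_symm_apply]
    have h2 : (‖(x + y * Complex.I : ℂ)‖ : ℂ) ^ 2 = x ^ 2 + y ^ 2 := by
      rw [← Complex.ofReal_pow, ← Complex.normSq_eq_norm_sq, Complex.normSq_add_mul_I]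
      push_cast; rfl
    rw [h1, gaussMonomial, h2, pow_zero, pow_zero, mul_one, mul_one, ← Complex.exp_add,
      ← Complex.exp_add]
    congr 1
    simp only [map_add, map_mul, Complex.conj_ofReal, Complex.conj_I]
    linear_combination (-ζ * y / 2 + η * y / 2) * Complex.I_sq
  simp_rw [h]
  rw [integral_prod_mul
    (f := fun x : ℝ => Complex.exp (-(1 / 4) * x ^ 2 + (Complex.I * (ζ + η) / 2) * x + 0))
    (g := fun x : ℝ => Complex.exp (-(1 / 4) * x ^ 2 + ((ζ - η) / 2) * x + 0)),
    integral_cexp_quadratic (by norm_num), integral_cexp_quadratic (by norm_num)]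
  have h3 : ((Real.pi : ℂ) / -(-(1 / 4))) ^ (1 / 2 : ℂ) *
      ((Real.pi : ℂ) / -(-(1 / 4))) ^ (1 / 2 : ℂ) = 4 * Real.pi := by
    rw [← Complex.cpow_add _ _ (by simp [Real.pi_ne_zero])]
    norm_num; ring
  calc _ = (((Real.pi : ℂ) / -(-(1 / 4))) ^ (1 / 2 : ℂ) *
      ((Real.pi : ℂ) / -(-(1 / 4))) ^ (1 / 2 : ℂ)) *
      (Complex.exp (0 - (Complex.I * (ζ + η) / 2) ^ 2 / (4 * -(1 / 4))) *
        Complex.exp (0 - ((ζ - η) / 2) ^ 2 / (4 * -(1 / 4)))) := by ring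
    _ = _ := by
      rw [h3, ← Complex.exp_add]
      congr 2
      linear_combination (ζ + η) ^ 2 / 4 * Complex.I_sq

lemma gaussInt_zero_left (q : ℕ) (ζ η : ℂ) :
    gaussInt 0 q ζ η = 4 * Real.pi * ((Complex.I * ζ) ^ q * Complex.exp (-(ζ * η))) := by
  induction q generalizing η with
  | zero => simp [gaussInt_zero_zero]
  | succ q ih =>
    have h1 := hasDerivAt_gaussInt_right 0 q ζ η
    have h2 : HasDerivAt (fun η => gaussInt 0 q ζ η)
        (4 * Real.pi * ((Complex.I * ζ) ^ q * (Complex.exp (-(ζ * η)) * (-ζ)))) η := by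
      simp_rw [ih]
      refine HasDerivAt.const_mul _ (HasDerivAt.const_mul _ (HasDerivAt.cexp ?_))
      exact ((hasDerivAt_id η).const_mul ζ).neg.congr_deriv (by simp)
    have h3 := h1.unique h2
    calc gaussInt 0 (q + 1) ζ η = -(Complex.I * (Complex.I * gaussInt 0 (q + 1) ζ η)) := by
          rw [← mul_assoc, Complex.I_mul_I]; ring
      _ = _ := by rw [h3]; ring

lemma gaussInt_eq_iteratedDeriv (p q : ℕ) (ζ η : ℂ) :
    gaussInt p q ζ η = (-Complex.I) ^ p * iteratedDeriv p (fun ζ => gaussInt 0 q ζ η) ζ := by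
  induction p generalizing ζ with
  | zero => simp
  | succ p ih =>
    have h1 := hasDerivAt_gaussInt_left p q ζ η
    have h3 : iteratedDeriv p (fun ζ => gaussInt 0 q ζ η) =
        fun ζ => Complex.I ^ p * gaussInt p q ζ η := by
      ext ζ
      rw [ih, ← mul_assoc, ← mul_pow]; simp
    rw [iteratedDeriv_succ, h3, (h1.const_mul (Complex.I ^ p)).deriv]
    have : (-Complex.I) ^ (p + 1) * (Complex.I ^ p * (Complex.I * gaussInt (p + 1) q ζ η)) =
      (-Complex.I * Complex.I) ^ (p + 1) * gaussInt (p + 1) q ζ η := by ring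
    rw [this]; simp

/-- Leibniz rule for the `p`-th derivative in `ζ` of `ζ ^ q * exp (-ζ η)`. -/
lemma gaussInt_eq_sum (p q : ℕ) (ζ η : ℂ) :
    gaussInt p q ζ η = 4 * Real.pi * (-Complex.I) ^ p * Complex.I ^ q *
      ∑ k ∈ Finset.range (p + 1), (p.choose k : ℂ) * (q.descFactorial k * ζ ^ (q - k)) *
        ((-η) ^ (p - k) * Complex.exp (-(ζ * η))) := by
  rw [gaussInt_eq_iteratedDeriv]
  have h : (fun ζ => gaussInt 0 q ζ η) = fun ζ => (4 * Real.pi * Complex.I ^ q) *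
      (ζ ^ q * Complex.exp ((-η) * ζ)) := by
    ext ζ
    rw [gaussInt_zero_left, mul_pow]; ring_nf
  rw [h, iteratedDeriv_const_mul_field, iteratedDeriv_fun_mul (by fun_prop) (by fun_prop)]
  simp_rw [iteratedDeriv_cexp_const_mul]
  simp only [iteratedDeriv_pow]
  rw [← mul_assoc, ← mul_assoc]
  have : ∀ x : ℂ, -η * x = -(x * η) := fun x => by ring
  simp only [this]
  congr 1
  ring

/-! ### Radial integrals of Gaussian monomials -/

lemma integrableOn_pow_mul_exp_neg_sq (N : ℕ) :
    IntegrableOn (fun A : ℝ => A ^ N * Real.exp (-A ^ 2)) (Set.Ioi 0) := by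
  have h := (integrable_rpow_mul_exp_neg_mul_sq (b := 1) one_pos (s := N)
    (by linarith [N.cast_nonneg (α := ℝ)])).integrableOn (s := Set.Ioi (0 : ℝ))
  simpa [Real.rpow_natCast] using h

lemma integral_pow_succ_mul_exp_neg_sq (N : ℕ) :
    ∫ A in Set.Ioi (0 : ℝ), A ^ (N + 1) * Real.exp (-A ^ 2) = Real.Gamma (1 + N / 2) / 2 := by
  have h := integral_rpow_mul_exp_neg_rpow (p := 2) (q := (N + 1 : ℕ)) two_pos
    (by linarith [(N + 1).cast_nonneg (α := ℝ)])
  simp only [Real.rpow_natCast, Real.rpow_ofNat] at h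
  rw [h]
  push_cast
  ring_nf

/-- The phase factor of the term of index `k` in the polar form of `gaussInt p q`. -/
def phaseFactor (p q k : ℕ) (θ : ℝ) : ℂ :=
  (p.choose k : ℂ) * q.descFactorial k * (-1) ^ (p - k) *
    (Complex.exp (Complex.I * θ) ^ (q - k) * Complex.exp (-(Complex.I * θ)) ^ (p - k))

lemma conj_mul_exp_I (A θ : ℝ) : conj ((A : ℂ) * Complex.exp (Complex.I * θ)) =
    A * Complex.exp (-(Complex.I * θ)) := by
  rw [map_mul, Complex.conj_ofReal, ← Complex.exp_conj]
  simp

lemma gaussInt_polar (p q : ℕ) (A θ : ℝ) :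
    gaussInt p q (A * Complex.exp (Complex.I * θ)) (conj (A * Complex.exp (Complex.I * θ))) =
      4 * Real.pi * (-Complex.I) ^ p * Complex.I ^ q * ∑ k ∈ Finset.range (p + 1),
        phaseFactor p q k θ * ((A ^ (q - k + (p - k)) * Real.exp (-A ^ 2) : ℝ) : ℂ) := by
  rw [gaussInt_eq_sum, conj_mul_exp_I]
  congr 1
  refine Finset.sum_congr rfl fun k _ => ?_
  have h : -((A : ℂ) * Complex.exp (Complex.I * θ) * (A * Complex.exp (-(Complex.I * θ)))) =
      ((-A ^ 2 : ℝ) : ℂ) := by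
    have : Complex.exp (Complex.I * θ) * Complex.exp (-(Complex.I * θ)) = 1 := by
      rw [← Complex.exp_add]; simp
    push_cast
    linear_combination (-(A : ℂ) ^ 2) * this
  rw [h, phaseFactor]
  push_cast
  rw [neg_pow ((A : ℂ) * _), mul_pow, mul_pow, pow_add]
  ring

lemma mul_gaussInt_polar (p q : ℕ) (A θ : ℝ) :
    (A : ℂ) * gaussInt p q (A * Complex.exp (Complex.I * θ))
      (conj (A * Complex.exp (Complex.I * θ))) =
      ∑ k ∈ Finset.range (p + 1), 4 * Real.pi * (-Complex.I) ^ p * Complex.I ^ q *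
        phaseFactor p q k θ * ((A ^ (q - k + (p - k) + 1) * Real.exp (-A ^ 2) : ℝ) : ℂ) := by
  rw [gaussInt_polar, Finset.mul_sum, Finset.mul_sum]
  refine Finset.sum_congr rfl fun k _ => ?_
  push_cast
  ring

lemma integrableOn_mul_gaussInt (p q : ℕ) (θ : ℝ) :
    IntegrableOn (fun A : ℝ => (A : ℂ) * gaussInt p q (A * Complex.exp (Complex.I * θ))
      (conj (A * Complex.exp (Complex.I * θ)))) (Set.Ioi 0) := by
  simp_rw [mul_gaussInt_polar]
  exact integrable_finsetSum _ fun k _ =>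
    (integrableOn_pow_mul_exp_neg_sq _).ofReal.const_mul _

lemma integral_mul_gaussInt (p q : ℕ) (θ : ℝ) :
    ∫ A in Set.Ioi (0 : ℝ), (A : ℂ) * gaussInt p q (A * Complex.exp (Complex.I * θ))
      (conj (A * Complex.exp (Complex.I * θ))) =
      2 * Real.pi * (-Complex.I) ^ p * Complex.I ^ q * ∑ k ∈ Finset.range (p + 1),
        phaseFactor p q k θ * (Real.Gamma (1 + (q - k + (p - k) : ℕ) / 2) : ℝ) := by
  simp_rw [mul_gaussInt_polar]
  rw [integral_finsetSum _ fun k _ => (integrableOn_pow_mul_exp_neg_sq _).ofReal.const_mul _]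
  simp_rw [integral_const_mul, integral_complex_ofReal, integral_pow_succ_mul_exp_neg_sq]
  rw [Finset.mul_sum]
  refine Finset.sum_congr rfl fun k _ => ?_
  push_cast
  ring

/-- The integral over the modulus of the inverse Fourier transform of a Gaussian monomial. -/
def radialMoment (p q : ℕ) (θ : ℝ) : ℂ :=
  (2 * Real.pi : ℂ)⁻¹ * ∫ A in Set.Ioi (0 : ℝ), (A : ℂ) *
    gaussInt p q (A * Complex.exp (Complex.I * θ)) (conj (A * Complex.exp (Complex.I * θ)))

lemma radialMoment_eq (p q : ℕ) (θ : ℝ) :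
    radialMoment p q θ = (-Complex.I) ^ p * Complex.I ^ q * ∑ k ∈ Finset.range (p + 1),
        phaseFactor p q k θ * (Real.Gamma (1 + (q - k + (p - k) : ℕ) / 2) : ℝ) := by
  have : (Real.pi : ℂ) ≠ 0 := by exact_mod_cast Real.pi_ne_zero
  rw [radialMoment, integral_mul_gaussInt]
  field_simp

lemma norm_exp_I_mul (θ : ℝ) : ‖Complex.exp (Complex.I * θ)‖ = 1 := by
  rw [mul_comm, Complex.norm_exp_ofReal_mul_I]

lemma norm_exp_neg_I_mul (θ : ℝ) : ‖Complex.exp (-(Complex.I * θ))‖ = 1 := by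
  rw [Complex.exp_neg, norm_inv, norm_exp_I_mul, inv_one]

lemma exists_norm_radialMoment_le (p q : ℕ) : ∃ K, ∀ θ, ‖radialMoment p q θ‖ ≤ K := by
  refine ⟨∑ k ∈ Finset.range (p + 1), (p.choose k : ℝ) * q.descFactorial k *
    ‖(Real.Gamma (1 + (q - k + (p - k) : ℕ) / 2) : ℝ)‖, fun θ => ?_⟩
  rw [radialMoment_eq]
  simp only [norm_mul, norm_pow, norm_neg, Complex.norm_I, one_pow, one_mul]
  refine (norm_sum_le _ _).trans (Finset.sum_le_sum fun k _ => le_of_eq ?_)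
  simp [phaseFactor, norm_exp_neg_I_mul]

/-- A pure power leaves only the term `k = 0` of the Leibniz sum. This is where the Gamma factors of
the main term originate. -/
lemma radialMoment_zero_right (p : ℕ) (θ : ℝ) : radialMoment p 0 θ =
    Complex.I ^ p * Real.Gamma (1 + p / 2) * Complex.exp (-(Complex.I * θ)) ^ p := by
  rw [radialMoment_eq, Finset.sum_eq_single 0]
  · simp only [phaseFactor, Nat.choose_zero_right, Nat.descFactorial_zero, Nat.sub_zero, zero_add]
    rw [neg_pow Complex.I]
    have : ((-1 : ℂ)) ^ p * (-1) ^ p = 1 := by rw [← mul_pow]; simp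
    simp only [Nat.cast_one, pow_zero, mul_one, one_mul]
    linear_combination (Complex.I ^ p * Complex.exp (-(Complex.I * θ)) ^ p *
      (Real.Gamma (1 + p / 2) : ℝ)) * this
  · intro k _ hk
    obtain ⟨k, rfl⟩ := Nat.exists_eq_succ_of_ne_zero hk
    simp [phaseFactor]
  · simp

lemma radialMoment_zero_left (q : ℕ) (θ : ℝ) : radialMoment 0 q θ =
    Complex.I ^ q * Real.Gamma (1 + q / 2) * Complex.exp (Complex.I * θ) ^ q := by
  rw [radialMoment_eq]
  simp [phaseFactor]
  ring

/-- The phases cancel, and `Γ(p - k + 1)` completes the descending factorial to `p!`. What remains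
is the alternating sum of binomial coefficients. -/
lemma radialMoment_self (p : ℕ) (θ : ℝ) : radialMoment p p θ = if p = 0 then 1 else 0 := by
  rw [radialMoment_eq]
  have h1 : ∀ k ∈ Finset.range (p + 1), phaseFactor p p k θ *
      (Real.Gamma (1 + (p - k + (p - k) : ℕ) / 2) : ℝ) =
      ((p ! : ℂ) * (-1) ^ p) * ((((-1) ^ k * (p.choose k : ℤ) : ℤ)) : ℂ) := by
    intro k hk
    have hk' : k ≤ p := Nat.lt_succ_iff.1 (Finset.mem_range.1 hk)
    have h2 : (1 + ((p - k + (p - k) : ℕ) : ℝ) / 2) = ((p - k : ℕ) : ℝ) + 1 := by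
      push_cast; ring
    have h3 : Complex.exp (Complex.I * θ) ^ (p - k) * Complex.exp (-(Complex.I * θ)) ^ (p - k)
        = 1 := by
      rw [← mul_pow, ← Complex.exp_add]; simp
    have h4 : ((p - k)! : ℂ) * p.descFactorial k = p ! := by
      exact_mod_cast Nat.factorial_mul_descFactorial hk'
    have h5 : (-1 : ℂ) ^ (p - k) = (-1) ^ p * (-1) ^ k := by
      rw [← pow_sub_mul_pow (-1 : ℂ) hk', mul_assoc, ← mul_pow]; simp
    rw [phaseFactor, h2, Real.Gamma_nat_eq_factorial, h3, h5, ← h4]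
    push_cast
    ring
  rw [Finset.sum_congr rfl h1, ← Finset.mul_sum, ← Int.cast_sum, Int.alternating_sum_range_choose]
  split_ifs with h
  · subst h; simp
  · simp

/-! ### Fourier modes of periodic random fields -/

lemma vol_pos {d : ℕ} {L : Fin d → ℝ} (hL : ∀ j, 0 < L j) : 0 < vol L :=
  Finset.prod_pos fun j _ => hL j

lemma volume_box_lt_top {d : ℕ} (L : Fin d → ℝ) : volume (box L) < ⊤ := by
  rw [box, volume_pi_pi]
  exact ENNReal.prod_lt_top fun j _ => by simp

instance isFiniteMeasure_restrict_box {d : ℕ} (L : Fin d → ℝ) :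
    IsFiniteMeasure ((volume : Measure (Fin d → ℝ)).restrict (box L)) :=
  ⟨by simpa using volume_box_lt_top L⟩

open scoped Pointwise in
/-- The integral of a periodic function over the box is invariant under translations. -/
lemma integral_box_add {d : ℕ} {L : Fin d → ℝ} (hL : ∀ j, 0 < L j) (h : (Fin d → ℝ) → ℂ)
    (hper : ∀ x j, h (x + Pi.single j (L j)) = h x) (a : Fin d → ℝ) :
    ∫ x in box L, h (x + a) = ∫ x in box L, h x := by
  -- The vectors `L j • e_j` span the period lattice, and the box is its fundamental domain. A
  -- translate of the box is again a fundamental domain, so a lattice-invariant function has the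
  -- same integral over both.
  let b : Module.Basis (Fin d) ℝ (Fin d → ℝ) :=
    (Pi.basisFun ℝ (Fin d)).isUnitSMul (w := L) fun j => (hL j).ne'.isUnit
  have hb : ∀ j, b j = Pi.single j (L j) := fun j => by
    simp only [b, Module.Basis.isUnitSMul_apply, Pi.basisFun_apply]
    rw [← Pi.single_smul]; simp
  have hrepr : ∀ x j, b.repr x j = x j / L j := by
    intro x j
    have hx : x = ∑ i, (x i / L i) • b i := by
      ext i
      simp [hb, Finset.sum_apply, Pi.single_apply, (hL i).ne']
    conv_lhs => rw [hx]
    simp [Finsupp.single_apply]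
  have hbox : box L = ZSpan.fundamentalDomain b := by
    ext x
    simp only [box, Set.mem_univ_pi, ZSpan.mem_fundamentalDomain, hrepr, Set.mem_Ico]
    refine forall_congr' fun j => ?_
    rw [div_lt_one (hL j), le_div_iff₀ (hL j), zero_mul]
  have hfd := ZSpan.isAddFundamentalDomain' b (volume : Measure (Fin d → ℝ))
  have hinv : ∀ (g : (Submodule.span ℤ (Set.range b)).toAddSubgroup) (x : Fin d → ℝ),
      h (g +ᵥ x) = h x := by
    rintro ⟨g, hg⟩ x
    change h (g + x) = h x
    induction hg using Submodule.span_induction generalizing x with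
    | mem y hy =>
      obtain ⟨j, rfl⟩ := hy
      rw [hb, add_comm, hper]
    | zero => simp
    | add y z _ _ hy hz => rw [add_assoc, hy, hz]
    | smul c y _ hy =>
      induction c using Int.induction_on generalizing x with
      | zero => simp
      | succ n ih => rw [add_smul, one_smul, add_assoc, ih, hy]
      | pred n ih =>
        rw [← hy ((-(n : ℤ) - 1) • y + x), ← add_assoc]
        convert ih x using 3
        rw [sub_smul, one_smul]; abel
  have : Countable (Submodule.span ℤ (Set.range b)).toAddSubgroup :=
    inferInstanceAs (Countable (Submodule.span ℤ (Set.range b)))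
  have hmp := measurePreserving_add_right (volume : Measure (Fin d → ℝ)) a
  have hset : box L = (fun x => x + a) ⁻¹' (a +ᵥ box L) := by
    ext x
    simp [Set.mem_vadd_set_iff_neg_vadd_mem, add_comm]
  conv_lhs => rw [hset]
  rw [hmp.setIntegral_preimage_emb (measurableEmbedding_addRight a) h, hbox]
  exact (hfd.vadd_of_comm a).setIntegral_eq hfd hinv

/-- The exponential `e^{-i k·x}`. -/
def wave {d : ℕ} (k x : Fin d → ℝ) : ℂ :=
  Complex.exp (-Complex.I * ((∑ j, k j * x j : ℝ) : ℂ))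

lemma norm_wave {d : ℕ} (k x : Fin d → ℝ) : ‖wave k x‖ = 1 := by
  rw [wave, neg_mul, norm_exp_neg_I_mul]

lemma continuous_wave {d : ℕ} (k : Fin d → ℝ) : Continuous (wave k) := by
  unfold wave; fun_prop

lemma wave_add {d : ℕ} (k x y : Fin d → ℝ) : wave k (x + y) = wave k x * wave k y := by
  simp only [wave]
  rw [← Complex.exp_add, ← mul_add, ← Complex.ofReal_add, ← Finset.sum_add_distrib]
  simp [mul_add]

lemma prod_wave {d : ℕ} {J : Type*} (s : Finset J) (k : J → Fin d → ℝ) (x : Fin d → ℝ) :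
    ∏ j ∈ s, wave (k j) x = wave (∑ j ∈ s, k j) x := by
  simp only [wave]
  rw [← Complex.exp_sum, ← Finset.mul_sum, ← Complex.ofReal_sum, Finset.sum_comm]
  simp [Finset.sum_mul]

lemma wave_single {d : ℕ} {L k : Fin d → ℝ} (hL : ∀ j, 0 < L j) (hk : IsWavevector L k)
    (j : Fin d) : wave k (Pi.single j (L j)) = 1 := by
  obtain ⟨z, hz⟩ := hk j
  have : ∑ i, k i * (Pi.single j (L j) : Fin d → ℝ) i = 2 * Real.pi * z := by
    rw [Finset.sum_eq_single j (fun i _ hi => by simp [hi]) (by simp)]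
    rw [Pi.single_eq_same, hz]
    field_simp [(hL j).ne']
  rw [wave, this, Complex.exp_eq_one_iff]
  exact ⟨-z, by push_cast; ring⟩

/-- The Fourier integral over the box without its normalization. -/
def rawMode {d : ℕ} {Ω : Type*} (L : Fin d → ℝ) (f : Ω → (Fin d → ℝ) → ℝ)
    (k : Fin d → ℝ) (ω : Ω) : ℂ :=
  ∫ x in box L, (f ω x : ℂ) * wave k x

lemma mode_eq {d : ℕ} {Ω : Type*} (L : Fin d → ℝ) (f : Ω → (Fin d → ℝ) → ℝ)
    (k : Fin d → ℝ) (ω : Ω) : mode L f k ω = rawMode L f k ω / (Real.sqrt (vol L) : ℂ) := rfl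

lemma conj_mode {d : ℕ} {Ω : Type*} (L : Fin d → ℝ) (f : Ω → (Fin d → ℝ) → ℝ)
    (k : Fin d → ℝ) (ω : Ω) : conj (mode L f k ω) = mode L f (-k) ω := by
  rw [mode_eq, mode_eq, map_div₀, Complex.conj_ofReal, rawMode, rawMode, ← integral_conj]
  congr 2
  ext x
  rw [map_mul, Complex.conj_ofReal, wave, ← Complex.exp_conj]
  simp [wave]

lemma prod_rawMode {d : ℕ} {Ω : Type*} (L : Fin d → ℝ) (f : Ω → (Fin d → ℝ) → ℝ)
    {J : Type*} [Fintype J] (k : J → Fin d → ℝ) (ω : Ω) :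
    ∏ j, rawMode L f (k j) ω = ∫ x, ∏ j, ((f ω (x j) : ℂ) * wave (k j) (x j))
      ∂(Measure.pi fun _ : J => volume.restrict (box L)) :=
  (integral_fintype_prod_eq_prod fun j x => (f ω x : ℂ) * wave (k j) x).symm

/-! ### Moments of products of Fourier modes -/

section Fubini

variable {d : ℕ} {Ω : Type*} [MeasurableSpace Ω] {μ : Measure Ω}
  {L : Fin d → ℝ} {f : Ω → (Fin d → ℝ) → ℝ} {J : Type*} [Fintype J]

/-- The product is at most a power of its largest factor. Products of field values at different
points are thus controlled by one-point moments. -/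
lemma prod_abs_le_one_add_sum_pow (a : J → ℝ) :
    ∏ j, |a j| ≤ 1 + ∑ j, |a j| ^ Fintype.card J := by
  rcases isEmpty_or_nonempty J with h | h
  · simp
  · obtain ⟨i, -, hi⟩ := Finset.exists_max_image Finset.univ (fun j => |a j|)
      Finset.univ_nonempty
    calc ∏ j, |a j| ≤ ∏ _j : J, |a i| :=
          Finset.prod_le_prod (fun j _ => abs_nonneg _) fun j hj => hi j hj
      _ = |a i| ^ Fintype.card J := by simp
      _ ≤ ∑ j, |a j| ^ Fintype.card J :=
          Finset.single_le_sum (f := fun j => |a j| ^ Fintype.card J)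
            (fun j _ => by positivity) (Finset.mem_univ i)
      _ ≤ _ := by linarith

lemma integrable_prod_field [IsProbabilityMeasure μ] (hm : Measurable (Function.uncurry f))
    (hf : ∀ N : ℕ, Integrable (fun z : Ω × (Fin d → ℝ) => |f z.1 z.2| ^ N)
      (μ.prod (volume.restrict (box L)))) (k : J → Fin d → ℝ) :
    Integrable (fun z : Ω × (J → Fin d → ℝ) => ∏ j, ((f z.1 (z.2 j) : ℂ) * wave (k j) (z.2 j)))
      (μ.prod (Measure.pi fun _ => volume.restrict (box L))) := by
  have hfj : ∀ j : J, Measurable fun z : Ω × (J → Fin d → ℝ) => f z.1 (z.2 j) := fun j =>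
    hm.comp (measurable_fst.prodMk ((measurable_pi_apply j).comp measurable_snd))
  have hw : ∀ j : J, Measurable fun z : Ω × (J → Fin d → ℝ) => wave (k j) (z.2 j) := fun j =>
    (continuous_wave (k j)).measurable.comp ((measurable_pi_apply j).comp measurable_snd)
  have hj : ∀ j : J, Integrable (fun z : Ω × (J → Fin d → ℝ) =>
      |f z.1 (z.2 j)| ^ Fintype.card J)
      (μ.prod (Measure.pi fun _ => volume.restrict (box L))) := by
    intro j
    classical
    let ν : Measure (Fin d → ℝ) := volume.restrict (box L)
    -- Projecting the product of box measures to one coordinate multiplies the measure by the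
    -- volumes of the other boxes, which are finite.
    obtain ⟨c, hc, hmap⟩ : ∃ c : ENNReal, c ≠ ⊤ ∧
        (Measure.pi fun _ : J => ν).map (Function.eval j) = c • ν :=
      ⟨_, (ENNReal.prod_lt_top fun i _ => measure_lt_top _ _).ne, Measure.pi_map_eval _ j⟩
    have hmp : MeasurePreserving (fun z : Ω × (J → Fin d → ℝ) => (z.1, z.2 j))
        (μ.prod (Measure.pi fun _ => ν)) (c • μ.prod ν) := by
      have h1 : MeasurePreserving (Function.eval j) (Measure.pi fun _ : J => ν) (c • ν) :=
        ⟨measurable_pi_apply j, hmap⟩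
      have : SFinite (c • ν) := by rw [← hmap]; infer_instance
      have h2 := (MeasurePreserving.id μ).prod h1
      rw [Measure.prod_smul_right] at h2
      exact h2
    exact hmp.integrable_comp_of_integrable ((hf (Fintype.card J)).smul_measure hc)
  refine ((integrable_const (1 : ℝ)).add (integrable_finsetSum Finset.univ fun j _ => hj j)).mono'
    ?_ (ae_of_all _ fun z => ?_)
  · exact (Finset.measurable_prod _ fun j _ =>
      (Complex.measurable_ofReal.comp (hfj j)).mul (hw j)).aestronglyMeasurable
  · rw [norm_prod]
    simp only [norm_mul, norm_wave, mul_one, Complex.norm_real, Real.norm_eq_abs]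
    exact prod_abs_le_one_add_sum_pow _

lemma integrable_prod_rawMode [IsProbabilityMeasure μ] (hm : Measurable (Function.uncurry f))
    (hf : ∀ N : ℕ, Integrable (fun z : Ω × (Fin d → ℝ) => |f z.1 z.2| ^ N)
      (μ.prod (volume.restrict (box L)))) (k : J → Fin d → ℝ) :
    Integrable (fun ω => ∏ j, rawMode L f (k j) ω) μ := by
  simp_rw [prod_rawMode]
  exact (integrable_prod_field hm hf k).integral_prod_left

lemma integral_prod_rawMode [IsProbabilityMeasure μ] (hm : Measurable (Function.uncurry f))
    (hf : ∀ N : ℕ, Integrable (fun z : Ω × (Fin d → ℝ) => |f z.1 z.2| ^ N)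
      (μ.prod (volume.restrict (box L)))) (k : J → Fin d → ℝ) :
    ∫ ω, ∏ j, rawMode L f (k j) ω ∂μ =
      ∫ x, ((∫ ω, ∏ j, f ω (x j) ∂μ : ℝ) : ℂ) * ∏ j, wave (k j) (x j)
        ∂(Measure.pi fun _ : J => volume.restrict (box L)) := by
  simp_rw [prod_rawMode]
  rw [integral_integral_swap (integrable_prod_field hm hf k)]
  congr 1
  ext x
  simp_rw [Finset.prod_mul_distrib]
  rw [integral_mul_const, ← integral_complex_ofReal]
  push_cast
  rfl

lemma IsHomogeneousField.identDistrib_prod (hf : IsHomogeneousField μ L f) (a : Fin d → ℝ)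
    (x : J → Fin d → ℝ) :
    IdentDistrib (fun ω => ∏ j, f ω (x j + a)) (fun ω => ∏ j, f ω (x j)) μ μ := by
  let e := Fintype.equivFin J
  have h := (hf.homogeneous a (Fintype.card J) (fun i => x (e.symm i))).comp
    (u := fun y : Fin (Fintype.card J) → ℝ => ∏ i, y i)
    (Finset.measurable_prod _ fun i _ => measurable_pi_apply i)
  convert h using 1
  · ext ω; exact (Equiv.prod_comp e.symm fun j => f ω (x j + a)).symm
  · ext ω; exact (Equiv.prod_comp e.symm fun j => f ω (x j)).symm

/-- At each point the shifted and the original field have the same law, so the two iterated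
integrals agree. This allows Fubini for the shifted field too. -/
lemma IsHomogeneousField.moments_shift [IsProbabilityMeasure μ]
    (hf : IsHomogeneousField μ L f) (a : Fin d → ℝ) (N : ℕ) :
    Integrable (fun z : Ω × (Fin d → ℝ) => |f z.1 (z.2 + a)| ^ N)
      (μ.prod (volume.restrict (box L))) := by
  have hm : Measurable fun z : Ω × (Fin d → ℝ) => |f z.1 (z.2 + a)| ^ N :=
    (hf.measurable.comp (measurable_fst.prodMk (measurable_snd.add_const a))).abs.pow_const N
  have hid : ∀ x, IdentDistrib (fun ω => |f ω (x + a)| ^ N) (fun ω => |f ω x| ^ N) μ μ := by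
    intro x
    have h := (hf.identDistrib_prod (J := Unit) a fun _ => x).comp
      (u := fun y : ℝ => |y| ^ N) (by fun_prop)
    simpa [Function.comp_def] using h
  have h0 := (integrable_prod_iff' (hf.moments N).aestronglyMeasurable).1 (hf.moments N)
  refine (integrable_prod_iff' hm.aestronglyMeasurable).2 ⟨?_, ?_⟩
  · filter_upwards [h0.1] with x hx
    exact (hid x).integrable_iff.2 hx
  · refine h0.2.congr (ae_of_all _ fun x => ?_)
    exact ((hid x).norm.integral_eq).symm

/-- For a wavevector of the box the integrand is periodic, so the variable of integration may be
translated by `a`; the exponential then releases the phase `wave k a`. -/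
lemma rawMode_shift (hL : ∀ j, 0 < L j) (hf : IsHomogeneousField μ L f) {k : Fin d → ℝ}
    (hk : IsWavevector L k) (a : Fin d → ℝ) (ω : Ω) :
    rawMode L f k ω = rawMode L (fun ω x => f ω (x + a)) k ω * wave k a := by
  rw [rawMode, rawMode, ← integral_mul_const,
    ← integral_box_add hL _
      (fun x j => by rw [hf.periodic, wave_add, wave_single hL hk, mul_one]) a]
  congr 1
  ext x
  rw [wave_add, mul_assoc]

/-- Moments of Fourier modes of a homogeneous field vanish unless the wavevectors add up to `0`. -/
lemma integral_prod_rawMode_eq_zero [IsProbabilityMeasure μ]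
    (hL : ∀ j, 0 < L j) (hf : IsHomogeneousField μ L f)
    {k : J → Fin d → ℝ} (hk : ∀ j, IsWavevector L (k j)) (hsum : ∑ j, k j ≠ 0) :
    ∫ ω, ∏ j, rawMode L f (k j) ω ∂μ = 0 := by
  obtain ⟨i, hi⟩ : ∃ i, (∑ j, k j) i ≠ 0 := by
    by_contra! h
    exact hsum (funext h)
  -- This translation gives the product of modes the total phase `-π`. Homogeneity then makes the
  -- moment equal to its own negative.
  set a : Fin d → ℝ := Pi.single i (Real.pi / (∑ j, k j) i) with ha
  have hwave : ∏ j, wave (k j) a = -1 := by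
    rw [prod_wave, wave]
    have : ∑ l, (∑ j, k j) l * a l = Real.pi := by
      rw [Finset.sum_eq_single i (fun l _ hl => by simp [ha, hl]) (by simp), ha,
        Pi.single_eq_same]
      field_simp
    rw [this, neg_mul, Complex.exp_neg, mul_comm, Complex.exp_pi_mul_I]
    norm_num
  have hms : Measurable (Function.uncurry fun ω x => f ω (x + a)) :=
    hf.measurable.comp (measurable_fst.prodMk (measurable_snd.add_const a))
  have h1 : ∫ ω, ∏ j, rawMode L f (k j) ω ∂μ =
      (∫ ω, ∏ j, rawMode L (fun ω x => f ω (x + a)) (k j) ω ∂μ) * -1 := by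
    rw [← integral_mul_const, ← hwave]
    congr 1
    ext ω
    rw [← Finset.prod_mul_distrib]
    exact Finset.prod_congr rfl fun j _ => rawMode_shift hL hf (hk j) a ω
  rw [integral_prod_rawMode hms (hf.moments_shift a)] at h1
  simp_rw [(hf.identDistrib_prod a _).integral_eq] at h1
  rw [← integral_prod_rawMode hf.measurable hf.moments] at h1
  linear_combination h1 / 2

end Fubini

/-! ### Joint cumulants -/

/-- The complex random variables with finite moments of all orders. -/
def momentAlgebra {Ω : Type*} [MeasurableSpace Ω] (μ : Measure Ω) [IsFiniteMeasure μ] :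
    Subalgebra ℂ (Ω → ℂ) where
  carrier := {Z | AEStronglyMeasurable Z μ ∧ ∀ N : ℕ, Integrable (fun ω => ‖Z ω‖ ^ N) μ}
  mul_mem' := by
    rintro Z W ⟨hZ, hZN⟩ ⟨hW, hWN⟩
    refine ⟨hZ.mul hW, fun N => ((hZN (2 * N)).add (hWN (2 * N))).mono'
      ((hZ.mul hW).norm.pow N) (ae_of_all _ fun ω => ?_)⟩
    simp only [Pi.mul_apply, Pi.add_apply, norm_mul, norm_pow, norm_norm, mul_pow, mul_comm 2 N,
      pow_mul]
    nlinarith [two_mul_le_add_sq (‖Z ω‖ ^ N) (‖W ω‖ ^ N), sq_nonneg (‖Z ω‖ ^ N),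
      sq_nonneg (‖W ω‖ ^ N)]
  add_mem' := by
    rintro Z W ⟨hZ, hZN⟩ ⟨hW, hWN⟩
    refine ⟨hZ.add hW, fun N => (((hZN N).add (hWN N)).const_mul (2 ^ (N - 1))).mono'
      ((hZ.add hW).norm.pow N) (ae_of_all _ fun ω => ?_)⟩
    simp only [Pi.add_apply, norm_pow, norm_norm]
    exact (pow_le_pow_left₀ (norm_nonneg _) (norm_add_le _ _) N).trans
      (add_pow_le (norm_nonneg _) (norm_nonneg _) N)
  algebraMap_mem' r :=
    ⟨aestronglyMeasurable_const (b := r), fun N => integrable_const (‖r‖ ^ N)⟩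

lemma prod_update_apply_of_notMem {Ω : Type*} {N : ℕ} {i : Fin N} {B : Finset (Fin N)} (hi : i ∉ B)
    (X : Fin N → Ω → ℂ) (Z : Ω → ℂ) (ω : Ω) :
    ∏ j ∈ B, Function.update X i Z j ω = ∏ j ∈ B, X j ω :=
  Finset.prod_congr rfl fun j hj => by
    rw [Function.update_of_ne (ne_of_mem_of_not_mem hj hi)]

lemma prod_update_apply_of_mem {Ω : Type*} {N : ℕ} {i : Fin N} {B : Finset (Fin N)} (hi : i ∈ B)
    (X : Fin N → Ω → ℂ) (Z : Ω → ℂ) (ω : Ω) :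
    ∏ j ∈ B, Function.update X i Z j ω = Z ω * ∏ j ∈ B.erase i, X j ω := by
  rw [← Finset.mul_prod_erase B _ hi, Function.update_self,
    prod_update_apply_of_notMem (Finset.notMem_erase i B)]

section Cumulants

variable {Ω : Type*} [MeasurableSpace Ω] {μ : Measure Ω} {N : ℕ}

lemma integrable_of_mem_momentAlgebra [IsFiniteMeasure μ] {Z : Ω → ℂ}
    (hZ : Z ∈ momentAlgebra μ) : Integrable Z μ :=
  (integrable_norm_iff hZ.1).1 (by simpa using hZ.2 1)

/-- Exactly one block of a partition contains `i`; all the others are insensitive to a change of the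
`i`-th entry. -/
lemma prod_parts_update_congr {M : Type*} [CommMonoid M] 
    (π : Finpartition (Finset.univ : Finset (Fin N))) (i : Fin N) (F G : Finset (Fin N) → M)
    (h : ∀ B, i ∉ B → F B = G B) :
    ∏ B ∈ π.parts.erase (π.part i), F B = ∏ B ∈ π.parts.erase (π.part i), G B := by
  refine Finset.prod_congr rfl fun B hB => h B fun hi => ?_
  rw [Finset.mem_erase] at hB
  exact hB.1 (π.part_eq_of_mem hB.2 hi).symm

/-- A joint cumulant with one entry replaced, as a linear expression in this entry. -/
lemma jointCumulant_update (X : Fin N → Ω → ℂ) (i : Fin N) (Z : Ω → ℂ) :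
    jointCumulant μ (Function.update X i Z) =
      ∑ π : Finpartition (Finset.univ : Finset (Fin N)),
        ((-1) ^ (π.parts.card - 1) * ((π.parts.card - 1)! : ℂ) *
          ∏ B ∈ π.parts.erase (π.part i), ∫ ω, ∏ j ∈ B, X j ω ∂μ) *
        ∫ ω, Z ω * ∏ j ∈ (π.part i).erase i, X j ω ∂μ := by
  refine Finset.sum_congr rfl fun π _ => ?_
  rw [← Finset.mul_prod_erase π.parts _ (π.part_mem.2 (Finset.mem_univ i)),
    prod_parts_update_congr π i _ (fun B => ∫ ω, ∏ j ∈ B, X j ω ∂μ) fun B hB => by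
      simp_rw [prod_update_apply_of_notMem hB]]
  simp_rw [prod_update_apply_of_mem (π.mem_part (Finset.mem_univ i))]
  ring

/-- The joint cumulant as a multilinear map. -/
def cumulantMap (μ : Measure Ω) [IsFiniteMeasure μ] (N : ℕ) :
    MultilinearMap ℂ (fun _ : Fin N => momentAlgebra μ) ℂ where
  toFun X := jointCumulant μ fun j => (X j : Ω → ℂ)
  map_update_add' := by
    intro inst X i Z W
    obtain rfl : inst = instDecidableEqFin N := Subsingleton.elim _ _
    have hu : ∀ U : momentAlgebra μ, (fun j => ((Function.update X i U) j : Ω → ℂ)) =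
        Function.update (fun j => (X j : Ω → ℂ)) i U := by
      intro U
      ext j : 1
      by_cases h : j = i
      · subst h; simp
      · simp [h]
    rw [hu, hu, hu, jointCumulant_update, jointCumulant_update, jointCumulant_update,
      ← Finset.sum_add_distrib]
    refine Finset.sum_congr rfl fun π _ => ?_
    rw [← mul_add, ← integral_add]
    · simp [add_mul]
    all_goals
      have hp : (∏ j ∈ (π.part i).erase i, (X j : Ω → ℂ)) ∈ momentAlgebra μ :=
        Subalgebra.prod_mem _ fun j _ => (X j).2
    · have := integrable_of_mem_momentAlgebra ((momentAlgebra μ).mul_mem Z.2 hp)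
      simpa [Finset.prod_apply, Pi.mul_def] using this
    · have := integrable_of_mem_momentAlgebra ((momentAlgebra μ).mul_mem W.2 hp)
      simpa [Finset.prod_apply, Pi.mul_def] using this
  map_update_smul' := by
    intro inst X i c Z
    obtain rfl : inst = instDecidableEqFin N := Subsingleton.elim _ _
    have hu : ∀ U : momentAlgebra μ, (fun j => ((Function.update X i U) j : Ω → ℂ)) =
        Function.update (fun j => (X j : Ω → ℂ)) i U := by
      intro U
      ext j : 1
      by_cases h : j = i
      · subst h; simp
      · simp [h]
    rw [hu, hu, jointCumulant_update, jointCumulant_update, smul_eq_mul, Finset.mul_sum]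
    refine Finset.sum_congr rfl fun π _ => ?_
    simp only [SetLike.val_smul, Pi.smul_apply, smul_eq_mul, mul_assoc]
    rw [integral_const_mul]
    ring

/-- Multilinear expansion. Applied to `X` as a combination of the four amplitudes, it makes the
cumulants of `X` polynomials in the conjugate variables. -/
lemma jointCumulant_sum_mul [IsFiniteMeasure μ] {C : Type*} [Fintype C] {Z : C → Ω → ℂ}
    (hZ : ∀ c, Z c ∈ momentAlgebra μ) (a : Fin N → C → ℂ) :
    jointCumulant μ (fun j ω => ∑ c, a j c * Z c ω) =
      ∑ g : Fin N → C, (∏ j, a j (g j)) * jointCumulant μ fun j => Z (g j) := by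
  classical
  have h1 : jointCumulant μ (fun j ω => ∑ c, a j c * Z c ω) =
      cumulantMap μ N fun j => ∑ c, a j c • (⟨Z c, hZ c⟩ : momentAlgebra μ) := by
    rw [cumulantMap, MultilinearMap.coe_mk]
    congr 1
    ext j ω
    simp
  rw [h1, MultilinearMap.map_sum]
  refine Finset.sum_congr rfl fun g _ => ?_
  rw [MultilinearMap.map_smul_univ]
  rfl

lemma jointCumulant_mul_left [IsFiniteMeasure μ] {X : Fin N → Ω → ℂ}
    (hX : ∀ j, X j ∈ momentAlgebra μ) (a : Fin N → ℂ) :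
    jointCumulant μ (fun j ω => a j * X j ω) = (∏ j, a j) * jointCumulant μ X := by
  have := (cumulantMap μ N).map_smul_univ a fun j => ⟨X j, hX j⟩
  exact this

lemma jointCumulant_conj (X : Fin N → Ω → ℂ) :
    jointCumulant μ (fun j ω => conj (X j ω)) = conj (jointCumulant μ X) := by
  simp only [jointCumulant, map_sum, map_mul, map_prod, ← integral_conj, map_pow, map_neg,
    map_one, map_natCast]

/-- The image of a partition under a permutation. -/
def permPartition (σ : Equiv.Perm (Fin N)) (π : Finpartition (Finset.univ : Finset (Fin N))) :
    Finpartition (Finset.univ : Finset (Fin N)) :=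
  (π.map (σ.finsetCongr.toOrderIso (fun _ _ h => Finset.map_subset_map.2 h)
    fun _ _ h => Finset.map_subset_map.2 h)).copy (Finset.map_univ_equiv σ)

lemma permPartition_injective (σ : Equiv.Perm (Fin N)) :
    Function.Injective (permPartition σ) := by
  intro π π' h
  have := congrArg Finpartition.parts h
  exact Finpartition.ext (Finset.map_injective _ this)

/-- A permutation of the indices permutes the set partitions, keeping the number of blocks and
carrying each block moment to the corresponding one. -/
lemma jointCumulant_comp_perm (X : Fin N → Ω → ℂ) (σ : Equiv.Perm (Fin N)) :
    jointCumulant μ (fun j => X (σ j)) = jointCumulant μ X := by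
  refine Fintype.sum_bijective (permPartition σ)
    (Finite.injective_iff_bijective.1 (permPartition_injective σ)) _ _ fun π => ?_
  have hcard : (permPartition σ π).parts.card = π.parts.card := Finset.card_map _
  rw [hcard]
  congr 1
  refine Eq.trans ?_ (Finset.prod_map _ _ _).symm
  refine Finset.prod_congr rfl fun B _ => ?_
  congr 1
  ext ω
  exact (Finset.prod_map B σ.toEmbedding fun j => X j ω).symm

/-- The joint cumulant vanishes if every partition has a block whose moment vanishes. -/
lemma jointCumulant_eq_zero (X : Fin N → Ω → ℂ)
    (h : ∀ π : Finpartition (Finset.univ : Finset (Fin N)), ∃ B ∈ π.parts,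
      ∫ ω, ∏ j ∈ B, X j ω ∂μ = 0) : jointCumulant μ X = 0 := by
  refine Finset.sum_eq_zero fun π _ => ?_
  obtain ⟨B, hB, h0⟩ := h π
  rw [Finset.prod_eq_zero hB h0, mul_zero]

end Cumulants

/-! ### Cumulants of Fourier modes vanish unless the wavevectors add up to zero -/

section Modes

variable {d : ℕ} {Ω : Type*} [MeasurableSpace Ω] {μ : Measure Ω} [IsProbabilityMeasure μ]
  {L : Fin d → ℝ} {f : Ω → (Fin d → ℝ) → ℝ}

lemma rawMode_mem_momentAlgebra (hf : IsHomogeneousField μ L f) (k : Fin d → ℝ) :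
    rawMode L f k ∈ momentAlgebra μ := by
  have h : ∀ N : ℕ, Integrable (fun ω => rawMode L f k ω ^ N) μ := fun N => by
    simpa using integrable_prod_rawMode hf.measurable hf.moments fun _ : Fin N => k
  refine ⟨by simpa using (h 1).aestronglyMeasurable, fun N => ?_⟩
  simpa using (h N).norm

lemma mode_mem_momentAlgebra (hf : IsHomogeneousField μ L f) (k : Fin d → ℝ) :
    mode L f k ∈ momentAlgebra μ := by
  have := (momentAlgebra μ).smul_mem (rawMode_mem_momentAlgebra hf k)
    ((Real.sqrt (vol L) : ℂ)⁻¹)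
  convert this using 1
  ext ω
  rw [mode_eq, Pi.smul_apply, smul_eq_mul, div_eq_inv_mul]

/-- If the total is non-zero, every partition has a block whose partial sum is non-zero, and
translation invariance makes the moment of that block vanish. -/
lemma jointCumulant_mode_eq_zero (hL : ∀ j, 0 < L j) (hf : IsHomogeneousField μ L f) {N : ℕ}
    {k : Fin N → Fin d → ℝ} (hk : ∀ j, IsWavevector L (k j)) (hsum : ∑ j, k j ≠ 0) :
    jointCumulant μ (fun j => mode L f (k j)) = 0 := by
  refine jointCumulant_eq_zero _ fun π => ?_
  obtain ⟨B, hB, h0⟩ : ∃ B ∈ π.parts, ∑ j ∈ B, k j ≠ 0 := by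
    by_contra! h
    refine hsum ?_
    rw [← π.biUnion_parts, Finset.sum_biUnion π.supIndep.pairwiseDisjoint]
    exact Finset.sum_eq_zero h
  refine ⟨B, hB, ?_⟩
  simp_rw [mode_eq, Finset.prod_div_distrib]
  rw [integral_div, div_eq_zero_iff]
  left
  simp_rw [← Finset.prod_coe_sort B]
  refine integral_prod_rawMode_eq_zero hL hf (fun j => hk j) ?_
  rwa [Finset.sum_coe_sort B]

end Modes

/-! ### Gaussian transforms of polynomials in the conjugate variables -/

/-- Labels of the four amplitudes `α₁, ᾱ₁, α₂, ᾱ₂`: the first component is `true` for the first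
mode, the second one is `false` for the complex conjugate. -/
abbrev Amplitude : Type := Bool × Bool

/-- The coefficients of `α₁, ᾱ₁, α₂, ᾱ₂` in `pairing w (α₁, α₂)`. -/
def coord (w : ℂ × ℂ) : Amplitude → ℂ
  | (true, true) => conj w.1 / 2
  | (true, false) => w.1 / 2
  | (false, true) => conj w.2 / 2
  | (false, false) => w.2 / 2

lemma prod_amplitude {M : Type*} [CommMonoid M] (F : Amplitude → M) :
    ∏ c, F c = F (true, true) * F (true, false) * (F (false, true) * F (false, false)) := by
  rw [Fintype.prod_prod_type, Fintype.prod_bool, Fintype.prod_bool, Fintype.prod_bool]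

lemma sum_amplitude {M : Type*} [AddCommMonoid M] (F : Amplitude → M) :
    ∑ c, F c = F (true, true) + F (true, false) + (F (false, true) + F (false, false)) := by
  rw [Fintype.sum_prod_type, Fintype.sum_bool, Fintype.sum_bool, Fintype.sum_bool]

/-- The integrand of the inverse Fourier transform of a polynomial times the Gaussian weight. -/
def gaussIntegrand (U : MvPolynomial Amplitude ℂ) (z w : ℂ × ℂ) : ℂ :=
  Complex.exp (Complex.I * (pairing w z : ℂ)) *
    (Complex.exp (-(((‖w.1‖ : ℂ) ^ 2 + (‖w.2‖ : ℂ) ^ 2) / 2) / 2) *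
      MvPolynomial.eval (coord w) U)

/-- The inverse Fourier transform of a polynomial times the Gaussian weight. -/
def gaussTransform (U : MvPolynomial Amplitude ℂ) (z : ℂ × ℂ) : ℂ :=
  (((2 * Real.pi) ^ 4 : ℝ) : ℂ)⁻¹ * ∫ w : ℂ × ℂ, gaussIntegrand U z w

lemma gaussIntegrand_add (U U' : MvPolynomial Amplitude ℂ) (z w : ℂ × ℂ) :
    gaussIntegrand (U + U') z w = gaussIntegrand U z w + gaussIntegrand U' z w := by
  simp only [gaussIntegrand, map_add]; ring

lemma ofReal_pairing (w z : ℂ × ℂ) : (pairing w z : ℂ) =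
    z.1 * (conj w.1 / 2) + conj z.1 * (w.1 / 2) +
      (z.2 * (conj w.2 / 2) + conj z.2 * (w.2 / 2)) := by
  apply Complex.ext <;> simp [pairing] <;> ring

/-- Monomials factorize over the two modes, which reduces every double integral below to a product
of integrals over one plane. -/
lemma gaussIntegrand_monomial (e : Amplitude →₀ ℕ) (a : ℂ) (z w : ℂ × ℂ) :
    gaussIntegrand (MvPolynomial.monomial e a) z w = a *
      ((Complex.exp (z.1 * (Complex.I * (conj w.1 / 2)) + conj z.1 * (Complex.I * (w.1 / 2))) *
          gaussMonomial (e (true, true)) (e (true, false)) w.1) *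
        (Complex.exp (z.2 * (Complex.I * (conj w.2 / 2)) + conj z.2 * (Complex.I * (w.2 / 2))) *
          gaussMonomial (e (false, true)) (e (false, false)) w.2)) := by
  rw [gaussIntegrand, MvPolynomial.eval_monomial, Finsupp.prod_fintype _ _ (fun _ => pow_zero _),
    prod_amplitude, gaussMonomial, gaussMonomial, ofReal_pairing]
  have h1 : Complex.I * (z.1 * (conj w.1 / 2) + conj z.1 * (w.1 / 2) +
      (z.2 * (conj w.2 / 2) + conj z.2 * (w.2 / 2))) =
      (z.1 * (Complex.I * (conj w.1 / 2)) + conj z.1 * (Complex.I * (w.1 / 2))) +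
      (z.2 * (Complex.I * (conj w.2 / 2)) + conj z.2 * (Complex.I * (w.2 / 2))) := by ring
  have h2 : -(((‖w.1‖ : ℂ) ^ 2 + (‖w.2‖ : ℂ) ^ 2) / 2) / 2 =
      -(‖w.1‖ : ℂ) ^ 2 / 4 + -(‖w.2‖ : ℂ) ^ 2 / 4 := by ring
  rw [h1, h2, Complex.exp_add, Complex.exp_add (-(‖w.1‖ : ℂ) ^ 2 / 4)]
  simp only [coord]
  ring

lemma integrable_gaussInt (p q : ℕ) (ζ η : ℂ) : Integrable fun w : ℂ =>
    Complex.exp (ζ * (Complex.I * (conj w / 2)) + η * (Complex.I * (w / 2))) *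
      gaussMonomial p q w :=
  integrable_gaussInt_aux p q (fun w => Complex.I * (conj w / 2)) (fun w => Complex.I * (w / 2))
    (by fun_prop) (by fun_prop) norm_I_mul_half_conj_le norm_I_mul_half_le ζ η

lemma integrable_gaussIntegrand (U : MvPolynomial Amplitude ℂ) (z : ℂ × ℂ) :
    Integrable (gaussIntegrand U z) := by
  induction U using MvPolynomial.induction_on' with
  | monomial e a =>
    have := ((integrable_gaussInt (e (true, true)) (e (true, false)) z.1 (conj z.1)).mul_prod
      (integrable_gaussInt (e (false, true)) (e (false, false)) z.2 (conj z.2))).const_mul a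
    exact this.congr (ae_of_all _ fun w => (gaussIntegrand_monomial e a z w).symm)
  | add U U' hU hU' =>
    exact (hU.add hU').congr (ae_of_all _ fun w => (gaussIntegrand_add U U' z w).symm)

lemma gaussTransform_add (U U' : MvPolynomial Amplitude ℂ) (z : ℂ × ℂ) :
    gaussTransform (U + U') z = gaussTransform U z + gaussTransform U' z := by
  simp only [gaussTransform, gaussIntegrand_add]
  rw [integral_add (integrable_gaussIntegrand U z) (integrable_gaussIntegrand U' z), mul_add]

lemma gaussTransform_monomial (e : Amplitude →₀ ℕ) (a : ℂ) (z : ℂ × ℂ) :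
    gaussTransform (MvPolynomial.monomial e a) z = (((2 * Real.pi) ^ 4 : ℝ) : ℂ)⁻¹ * (a *
      (gaussInt (e (true, true)) (e (true, false)) z.1 (conj z.1) *
        gaussInt (e (false, true)) (e (false, false)) z.2 (conj z.2))) := by
  simp only [gaussTransform, gaussIntegrand_monomial]
  rw [integral_const_mul, Measure.volume_eq_prod, integral_prod_mul
    (f := fun w : ℂ => Complex.exp (z.1 * (Complex.I * (conj w / 2)) +
      conj z.1 * (Complex.I * (w / 2))) * gaussMonomial (e (true, true)) (e (true, false)) w)
    (g := fun w : ℂ => Complex.exp (z.2 * (Complex.I * (conj w / 2)) +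
      conj z.2 * (Complex.I * (w / 2))) * gaussMonomial (e (false, true)) (e (false, false)) w)]
  rfl

/-- The value of `phaseFunctional` on a monomial. -/
def phaseWeight (θ : ℝ × ℝ) (e : Amplitude →₀ ℕ) : ℂ :=
  radialMoment (e (true, true)) (e (true, false)) θ.1 *
    radialMoment (e (false, true)) (e (false, false)) θ.2

/-- The phase distribution, multiplied by `(2π)²`, as a linear functional of the polynomial that
multiplies the Gaussian weight in Fourier space. -/
def phaseFunctional (θ : ℝ × ℝ) : MvPolynomial Amplitude ℂ →ₗ[ℂ] ℂ :=
  (MvPolynomial.basisMonomials Amplitude ℂ).constr ℂ (phaseWeight θ)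

lemma phaseFunctional_monomial (θ : ℝ × ℝ) (e : Amplitude →₀ ℕ) (a : ℂ) :
    phaseFunctional θ (MvPolynomial.monomial e a) = a * phaseWeight θ e := by
  have h : MvPolynomial.monomial e a = a • MvPolynomial.basisMonomials Amplitude ℂ e := by
    rw [MvPolynomial.coe_basisMonomials, MvPolynomial.smul_monomial, smul_eq_mul, mul_one]
  rw [h, map_smul, phaseFunctional, Module.Basis.constr_basis, smul_eq_mul]

lemma moduli_gaussTransform_monomial (e : Amplitude →₀ ℕ) (a : ℂ) (A θ : ℝ × ℝ) :
    (A.1 * A.2) • gaussTransform (MvPolynomial.monomial e a) (polar A θ) =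
      ((((2 * Real.pi) ^ 4 : ℝ) : ℂ)⁻¹ * a) *
      (((A.1 : ℂ) * gaussInt (e (true, true)) (e (true, false))
          (A.1 * Complex.exp (Complex.I * θ.1)) (conj (A.1 * Complex.exp (Complex.I * θ.1)))) *
        ((A.2 : ℂ) * gaussInt (e (false, true)) (e (false, false))
          (A.2 * Complex.exp (Complex.I * θ.2)) (conj (A.2 * Complex.exp (Complex.I * θ.2))))) := by
  rw [gaussTransform_monomial, Complex.real_smul]
  simp only [polar]
  push_cast
  ring

/-- The domain of integration over the moduli. -/
abbrev moduli : Set (ℝ × ℝ) := Set.Ioi (0 : ℝ) ×ˢ Set.Ioi (0 : ℝ)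

lemma restrict_moduli : (volume : Measure (ℝ × ℝ)).restrict moduli =
    (volume.restrict (Set.Ioi 0)).prod (volume.restrict (Set.Ioi 0)) := by
  rw [Measure.prod_restrict, ← Measure.volume_eq_prod]

lemma integrableOn_gaussTransform (U : MvPolynomial Amplitude ℂ) (θ : ℝ × ℝ) :
    IntegrableOn (fun A : ℝ × ℝ => (A.1 * A.2) • gaussTransform U (polar A θ)) moduli := by
  induction U using MvPolynomial.induction_on' with
  | monomial e a =>
    simp_rw [moduli_gaussTransform_monomial]
    rw [IntegrableOn, restrict_moduli]
    exact ((integrableOn_mul_gaussInt (e (true, true)) (e (true, false)) θ.1).mul_prod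
      (integrableOn_mul_gaussInt (e (false, true)) (e (false, false)) θ.2)).const_mul _
  | add U U' hU hU' =>
    simp_rw [gaussTransform_add, smul_add]
    exact hU.add hU'

lemma integrateModuli_gaussTransform (U : MvPolynomial Amplitude ℂ) (θ : ℝ × ℝ) :
    (((2 * Real.pi) ^ 2 : ℝ) : ℂ) * integrateModuli (gaussTransform U) θ =
      phaseFunctional θ U := by
  induction U using MvPolynomial.induction_on' with
  | monomial e a =>
    rw [integrateModuli, phaseFunctional_monomial, phaseWeight, radialMoment, radialMoment]
    simp_rw [moduli_gaussTransform_monomial]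
    have hpi : (Real.pi : ℂ) ≠ 0 := by exact_mod_cast Real.pi_ne_zero
    rw [integral_const_mul, restrict_moduli, integral_prod_mul
      (f := fun A : ℝ => (A : ℂ) * gaussInt (e (true, true)) (e (true, false))
          (A * Complex.exp (Complex.I * θ.1)) (conj (A * Complex.exp (Complex.I * θ.1))))
      (g := fun A : ℝ => (A : ℂ) * gaussInt (e (false, true)) (e (false, false))
          (A * Complex.exp (Complex.I * θ.2)) (conj (A * Complex.exp (Complex.I * θ.2))))]
    -- The remaining factor `(2π)⁻²` is shared equally between the modes, matching the normalization
    -- of `radialMoment`.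
    have key : ∀ x y : ℂ, (((2 * Real.pi) ^ 2 : ℝ) : ℂ) * (((((2 * Real.pi) ^ 4 : ℝ) : ℂ)⁻¹ * a) *
        (x * y)) = a * (((2 * Real.pi : ℂ)⁻¹ * x) * ((2 * Real.pi : ℂ)⁻¹ * y)) := by
      intro x y
      push_cast
      field_simp
    exact key _ _
  | add U U' hU hU' =>
    rw [map_add, ← hU, ← hU', ← mul_add]
    simp only [integrateModuli, gaussTransform_add, smul_add]
    rw [integral_add (integrableOn_gaussTransform U θ) (integrableOn_gaussTransform U' θ)]

lemma exists_norm_phaseFunctional_le (U : MvPolynomial Amplitude ℂ) :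
    ∃ K, ∀ θ, ‖phaseFunctional θ U‖ ≤ K := by
  induction U using MvPolynomial.induction_on' with
  | monomial e a =>
    obtain ⟨K₁, h₁⟩ := exists_norm_radialMoment_le (e (true, true)) (e (true, false))
    obtain ⟨K₂, h₂⟩ := exists_norm_radialMoment_le (e (false, true)) (e (false, false))
    refine ⟨‖a‖ * (K₁ * K₂), fun θ => ?_⟩
    rw [phaseFunctional_monomial, phaseWeight, norm_mul, norm_mul]
    have := (norm_nonneg _).trans (h₁ θ.1)
    gcongr
    exacts [h₁ _, h₂ _]
  | add U U' hU hU' =>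
    obtain ⟨K₁, h₁⟩ := hU
    obtain ⟨K₂, h₂⟩ := hU'
    refine ⟨K₁ + K₂, fun θ => ?_⟩
    rw [map_add]
    exact (norm_add_le _ _).trans (add_le_add (h₁ θ) (h₂ θ))

/-! ### Polynomials in the two intensities -/

/-- Substitution of the intensities `α_s ᾱ_s` for two variables. -/
def intensityMap : MvPolynomial Bool ℂ →ₐ[ℂ] MvPolynomial Amplitude ℂ :=
  MvPolynomial.aeval fun s => MvPolynomial.X (s, true) * MvPolynomial.X (s, false)

lemma intensityMap_monomial (e : Bool →₀ ℕ) (a : ℂ) :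
    intensityMap (MvPolynomial.monomial e a) =
      MvPolynomial.monomial (Finsupp.equivFunOnFinite.symm fun c : Amplitude => e c.1) a := by
  rw [intensityMap, MvPolynomial.aeval_monomial, MvPolynomial.monomial_eq,
    Finsupp.prod_fintype _ _ (fun _ => pow_zero _), Finsupp.prod_fintype _ _ (fun _ => pow_zero _),
    prod_amplitude, Fintype.prod_bool]
  simp only [mul_pow, Finsupp.equivFunOnFinite_symm_apply_apply]
  rfl

/-- On polynomials in the intensities only the constant term contributes to the phase
distribution. -/
lemma phaseFunctional_of_mem_range {U : MvPolynomial Amplitude ℂ}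
    (hU : U ∈ intensityMap.range) (θ : ℝ × ℝ) :
    phaseFunctional θ U = MvPolynomial.constantCoeff U := by
  obtain ⟨U, rfl⟩ := hU
  induction U using MvPolynomial.induction_on' with
  | monomial e a =>
    change phaseFunctional θ (intensityMap _) = MvPolynomial.constantCoeff (intensityMap _)
    rw [intensityMap_monomial, phaseFunctional_monomial, phaseWeight,
      MvPolynomial.constantCoeff_monomial]
    simp only [Finsupp.equivFunOnFinite_symm_apply_apply, radialMoment_self]
    have : (Finsupp.equivFunOnFinite.symm fun c : Amplitude => e c.1) = 0 ↔
        e true = 0 ∧ e false = 0 := by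
      simp [Finsupp.ext_iff]
      tauto
    by_cases h1 : e true = 0 <;> by_cases h2 : e false = 0 <;> simp [this, h1, h2]
  | add U U' hU hU' =>
    simp only [map_add] at *
    rw [hU, hU']

/-! ### Monomials attached to tuples of amplitudes -/

section Tuples

variable {N : ℕ}

/-- The number of occurrences of the amplitude `c` in a tuple. -/
def mult (g : Fin N → Amplitude) (c : Amplitude) : ℕ := (Finset.univ.filter fun j => g j = c).card

lemma prod_comp_eq_prod_pow_mult {M : Type*} [CommMonoid M] (g : Fin N → Amplitude)
    (F : Amplitude → M) : ∏ j, F (g j) = ∏ c, F c ^ mult g c := by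
  rw [← Finset.prod_fiberwise' Finset.univ g F]
  simp [mult]

lemma sum_comp_eq_sum_mult_smul {M : Type*} [AddCommMonoid M] (g : Fin N → Amplitude)
    (F : Amplitude → M) : ∑ j, F (g j) = ∑ c, mult g c • F c := by
  rw [← Finset.sum_fiberwise' Finset.univ g F]
  simp [mult]

lemma sum_mult (g : Fin N → Amplitude) : ∑ c, mult g c = N := by
  simpa using (sum_comp_eq_sum_mult_smul g fun _ => (1 : ℕ)).symm

/-- Both modes occur as often as their complex conjugates. -/
def IsBalanced (g : Fin N → Amplitude) : Prop :=
  mult g (true, true) = mult g (true, false) ∧ mult g (false, true) = mult g (false, false)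

/-- The monomial of a tuple of amplitudes. -/
def tupleMonomial (g : Fin N → Amplitude) : MvPolynomial Amplitude ℂ :=
  ∏ j, MvPolynomial.X (g j)

lemma tupleMonomial_mem_range {g : Fin N → Amplitude} (hg : IsBalanced g) :
    tupleMonomial g ∈ intensityMap.range := by
  refine ⟨MvPolynomial.X true ^ mult g (true, true) * MvPolynomial.X false ^ mult g (false, true),
    ?_⟩
  rw [tupleMonomial, prod_comp_eq_prod_pow_mult, prod_amplitude, ← hg.1, ← hg.2]
  simp [intensityMap, mul_pow]

lemma constantCoeff_tupleMonomial (hN : N ≠ 0) (g : Fin N → Amplitude) :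
    MvPolynomial.constantCoeff (tupleMonomial g) = 0 := by
  rw [tupleMonomial, map_prod]
  exact Finset.prod_eq_zero (Finset.mem_univ ⟨0, Nat.pos_of_ne_zero hN⟩) (by simp)

lemma phaseFunctional_tupleMonomial (θ : ℝ × ℝ) (g : Fin N → Amplitude) :
    phaseFunctional θ (tupleMonomial g) =
      radialMoment (mult g (true, true)) (mult g (true, false)) θ.1 *
        radialMoment (mult g (false, true)) (mult g (false, false)) θ.2 := by
  have h : tupleMonomial g =
      MvPolynomial.monomial (Finsupp.equivFunOnFinite.symm (mult g)) 1 := by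
    rw [tupleMonomial, prod_comp_eq_prod_pow_mult, MvPolynomial.monomial_eq,
      Finsupp.prod_fintype _ _ (fun _ => pow_zero _)]
    simp
  rw [h, phaseFunctional_monomial, one_mul]
  rfl

/-- Tuples with the same multiplicities differ by a permutation. -/
lemma exists_perm_of_mult_eq {g g' : Fin N → Amplitude} (h : ∀ c, mult g c = mult g' c) :
    ∃ σ : Equiv.Perm (Fin N), g = g' ∘ σ := by
  have e : ∀ c, Nonempty ({j // g j = c} ≃ {j // g' j = c}) := fun c => by
    rw [← Fintype.card_eq, Fintype.card_subtype, Fintype.card_subtype]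
    exact h c
  exact ⟨Equiv.ofFiberEquiv fun c => (e c).some, by
    ext j : 1; exact (Equiv.ofFiberEquiv_map (fun c => (e c).some) j).symm⟩

/-- The tuples with `n` entries `c` and `m` entries `c'`. -/
def twoTypeTuples (N n m : ℕ) (c c' : Amplitude) : Finset (Fin N → Amplitude) :=
  Finset.univ.filter fun g => mult g c = n ∧ mult g c' = m

lemma mem_twoTypeTuples {n m : ℕ} {c c' : Amplitude} {g : Fin N → Amplitude} :
    g ∈ twoTypeTuples N n m c c' ↔ mult g c = n ∧ mult g c' = m := by
  simp [twoTypeTuples]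

lemma mult_eq_zero_of_mem {n m : ℕ} {c c' : Amplitude} (hc : c ≠ c') (hN : N = n + m)
    {g : Fin N → Amplitude} (hg : g ∈ twoTypeTuples N n m c c') {c'' : Amplitude}
    (h : c'' ≠ c) (h' : c'' ≠ c') : mult g c'' = 0 := by
  rw [mem_twoTypeTuples] at hg
  have h1 := sum_mult g
  rw [← Finset.add_sum_erase _ _ (Finset.mem_univ c),
    ← Finset.add_sum_erase _ _ (Finset.mem_erase.2 ⟨hc.symm, Finset.mem_univ c'⟩), hg.1, hg.2] at h1
  have h2 : ∑ x ∈ (Finset.univ.erase c).erase c', mult g x = 0 := by omega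
  exact Finset.sum_eq_zero_iff.1 h2 c'' (by simp [h, h'])

lemma mem_of_mem_twoTypeTuples {n m : ℕ} {c c' : Amplitude} (hc : c ≠ c') (hN : N = n + m)
    {g : Fin N → Amplitude} (hg : g ∈ twoTypeTuples N n m c c') (j : Fin N) :
    g j = c ∨ g j = c' := by
  by_contra! h
  have h0 := mult_eq_zero_of_mem hc hN hg h.1 h.2
  have : j ∈ Finset.univ.filter fun i => g i = g j := by simp
  rw [Finset.card_eq_zero.1 h0] at this
  simp at this

/-- Such a tuple is determined by the set of positions of `c`. -/
lemma card_twoTypeTuples {n m : ℕ} {c c' : Amplitude} (hc : c ≠ c') (hN : N = n + m) :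
    (twoTypeTuples N n m c c').card = N.choose n := by
  have h : ((Finset.univ : Finset (Fin N)).powersetCard n).card = N.choose n := by simp
  rw [← h]
  refine Finset.card_nbij' (fun g => Finset.univ.filter fun j => g j = c)
    (fun S j => if j ∈ S then c else c') ?_ ?_ ?_ ?_
  · intro g hg
    rw [Finset.mem_coe, mem_twoTypeTuples] at hg
    simp only [Finset.mem_coe, Finset.mem_powersetCard, Finset.subset_univ, true_and]
    exact hg.1
  · intro S hS
    simp only [Finset.mem_coe, Finset.mem_powersetCard, Finset.subset_univ, true_and] at hS
    have h1 : (Finset.univ.filter fun j => (if j ∈ S then c else c') = c) = S := by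
      ext j; by_cases hj : j ∈ S <;> simp [hj, hc.symm]
    have h2 : (Finset.univ.filter fun j => (if j ∈ S then c else c') = c') = Sᶜ := by
      ext j; by_cases hj : j ∈ S <;> simp [hj, hc]
    rw [Finset.mem_coe, mem_twoTypeTuples, mult, mult, h1, h2, Finset.card_compl,
      Fintype.card_fin, hS]
    omega
  · intro g hg
    ext1 j
    rcases mem_of_mem_twoTypeTuples hc hN hg j with hj | hj <;> simp [hj, hc.symm]
  · intro S _
    ext j; by_cases hj : j ∈ S <;> simp [hj, hc.symm]

lemma mult_eq_mult_of_mem_twoTypeTuples {n m : ℕ} {c c' : Amplitude} (hc : c ≠ c')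
    (hN : N = n + m) {g g' : Fin N → Amplitude} (hg : g ∈ twoTypeTuples N n m c c')
    (hg' : g' ∈ twoTypeTuples N n m c c') (a : Amplitude) : mult g a = mult g' a := by
  have h1 := hg
  have h2 := hg'
  rw [mem_twoTypeTuples] at h1 h2
  rcases eq_or_ne a c with rfl | h
  · rw [h1.1, h2.1]
  · rcases eq_or_ne a c' with rfl | h'
    · rw [h1.2, h2.2]
    · rw [mult_eq_zero_of_mem hc hN hg h h', mult_eq_zero_of_mem hc hN hg' h h']

lemma append_mem_twoTypeTuples (n m : ℕ) {c c' : Amplitude} (hc : c ≠ c') :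
    Fin.append (fun _ : Fin n => c) (fun _ : Fin m => c') ∈ twoTypeTuples (n + m) n m c c' := by
  rw [mem_twoTypeTuples, mult, mult, Finset.card_filter, Finset.card_filter,
    Fin.sum_univ_add, Fin.sum_univ_add]
  simp [hc, hc.symm]

end Tuples

/-! ### Resonant tuples of wavevectors -/

/-- The wavevectors of the four amplitudes. -/
def signedMode {d : ℕ} (k₁ k₂ : Fin d → ℝ) : Amplitude → Fin d → ℝ
  | (true, true) => k₁
  | (true, false) => -k₁
  | (false, true) => k₂
  | (false, false) => -k₂

/-- The wavevectors `k₁ ≠ k₂` are non-zero and satisfy the primitive relation `n k₁ = m k₂`. -/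
structure Resonance {d : ℕ} (k₁ k₂ : Fin d → ℝ) (n m : ℕ) : Prop where
  ne_zero : k₁ ≠ 0
  ne : k₁ ≠ k₂
  pos_left : 0 < n
  pos_right : 0 < m
  coprime : Nat.Coprime n m
  smul_eq : (n : ℝ) • k₁ = (m : ℝ) • k₂

namespace Resonance

variable {d : ℕ} {k₁ k₂ : Fin d → ℝ} {n m N : ℕ}

/-- The case `n = m = 1` would force `k₁ = k₂`. The resonance therefore never enters the quadratic
cumulant. -/
lemma two_lt (h : Resonance k₁ k₂ n m) : 2 < n + m := by
  have h1 := h.pos_left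
  have h2 := h.pos_right
  by_contra! h3
  obtain ⟨rfl, rfl⟩ : n = 1 ∧ m = 1 := by omega
  exact h.ne (by simpa using h.smul_eq)

/-- The multiplicities of a tuple whose wavevectors add up to zero. -/
lemma exists_int (h : Resonance k₁ k₂ n m) {g : Fin N → Amplitude}
    (hg : ∑ j, signedMode k₁ k₂ (g j) = 0) : ∃ t : ℤ,
      (mult g (true, true) : ℤ) - mult g (true, false) = t * n ∧
      (mult g (false, true) : ℤ) - mult g (false, false) = -(t * m) := by
  rw [sum_comp_eq_sum_mult_smul, sum_amplitude] at hg
  obtain ⟨i, hi⟩ : ∃ i, k₁ i ≠ 0 := by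
    by_contra! h'
    exact h.ne_zero (funext h')
  set p := mult g (true, true)
  set q := mult g (true, false)
  set r := mult g (false, true)
  set s := mult g (false, false)
  have h1 : (p : ℝ) * k₁ i + q * -k₁ i + (r * k₂ i + s * -k₂ i) = 0 := by
    simpa [signedMode] using congrFun hg i
  have h2 : (n : ℝ) * k₁ i = m * k₂ i := by simpa using congrFun h.smul_eq i
  have h3 : (((p : ℤ) - q) * m + ((r : ℤ) - s) * n : ℝ) = 0 := by
    have : (((p : ℤ) - q) * m + ((r : ℤ) - s) * n : ℝ) * k₁ i = 0 := by
      push_cast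
      linear_combination (m : ℝ) * h1 + ((r : ℝ) - s) * h2
    exact (mul_eq_zero.1 this).resolve_right hi
  have h4 : ((p : ℤ) - q) * m + ((r : ℤ) - s) * n = 0 := by exact_mod_cast h3
  -- The zero-sum condition reads `(p - q) m = -(r - s) n`, so coprimality forces `n ∣ p - q`, and
  -- the quotient is `t`.
  have hcop : IsCoprime (n : ℤ) m := Nat.isCoprime_iff_coprime.2 h.coprime
  obtain ⟨t, ht⟩ : (n : ℤ) ∣ (p : ℤ) - q :=
    hcop.dvd_of_dvd_mul_right ⟨-((r : ℤ) - s), by linear_combination h4⟩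
  refine ⟨t, by rw [ht]; ring, ?_⟩
  have hn : (n : ℤ) ≠ 0 := by exact_mod_cast h.pos_left.ne'
  refine mul_right_cancel₀ hn ?_
  rw [ht] at h4
  linear_combination h4

/-- A tuple with excess parameter `t` has at least `|t| (n + m)` entries. With at most `n + m`
entries, `t ≠ 0` forces `t = ±1` and leaves no room for further amplitudes. -/
lemma mult_cases (h : Resonance k₁ k₂ n m) {g : Fin N → Amplitude}
    (hg : ∑ j, signedMode k₁ k₂ (g j) = 0) (hN : N ≤ n + m) : IsBalanced g ∨
      N = n + m ∧ (g ∈ twoTypeTuples N n m (true, true) (false, false) ∨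
        g ∈ twoTypeTuples N n m (true, false) (false, true)) := by
  obtain ⟨t, h1, h2⟩ := h.exists_int hg
  have h3 := sum_mult g
  rw [sum_amplitude] at h3
  simp only [mem_twoTypeTuples, IsBalanced]
  have hn : (0 : ℤ) < n := by exact_mod_cast h.pos_left
  have hm : (0 : ℤ) < m := by exact_mod_cast h.pos_right
  rcases lt_trichotomy t 0 with ht | rfl | ht
  · obtain ⟨u, rfl⟩ : ∃ u : ℕ, t = -(u + 1) := ⟨(-t - 1).toNat, by omega⟩
    have h5 : (u + 1 : ℤ) * n = u * n + n := by ring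
    have h6 : (u + 1 : ℤ) * m = u * m + m := by ring
    have h7 : (0 : ℤ) ≤ u * n := by positivity
    have h8 : (0 : ℤ) ≤ u * m := by positivity
    rw [neg_mul, h5] at h1
    rw [neg_mul, h6] at h2
    right; omega
  · left; omega
  · obtain ⟨u, rfl⟩ : ∃ u : ℕ, t = u + 1 := ⟨(t - 1).toNat, by omega⟩
    have h5 : (u + 1 : ℤ) * n = u * n + n := by ring
    have h6 : (u + 1 : ℤ) * m = u * m + m := by ring
    have h7 : (0 : ℤ) ≤ u * n := by positivity
    have h8 : (0 : ℤ) ≤ u * m := by positivity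
    rw [h5] at h1
    rw [h6] at h2
    right; omega

end Resonance

/-! ### The expansion in terms of the polyspectra -/

section Expansion

variable {d : ℕ} (P : Polyspectra d) (k₁ k₂ : Fin d → ℝ)

/-- The normalized polyspectrum of a tuple of amplitudes. -/
def ampSpectrum {N : ℕ} (g : Fin N → Amplitude) : ℂ :=
  normPolyspectrum P N fun j => signedMode k₁ k₂ (g j)

/-- The polynomial in Fourier space attached to the cumulant of order `r + 2`. -/
def exponentPoly (r : ℕ) : MvPolynomial Amplitude ℂ :=
  if r = 0 then 0
  else MvPolynomial.C ((-Complex.I) ^ (r + 2) / ((r + 2)! : ℂ)) *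
    ∑ g : Fin (r + 2) → Amplitude, MvPolynomial.C (ampSpectrum P k₁ k₂ g) * tupleMonomial g

/-- The polynomial in Fourier space multiplying the Gaussian weight at order `j`. -/
def expPoly (j : ℕ) : MvPolynomial Amplitude ℂ :=
  ∑ s ∈ Finset.range (j + 1), MvPolynomial.C ((s ! : ℂ)⁻¹) *
    PowerSeries.coeff j (PowerSeries.mk (exponentPoly P k₁ k₂) ^ s)

lemma constantCoeff_exponentPoly (r : ℕ) :
    MvPolynomial.constantCoeff (exponentPoly P k₁ k₂ r) = 0 := by
  rw [exponentPoly]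
  split_ifs with h
  · simp
  · rw [map_mul, map_sum]
    simp [constantCoeff_tupleMonomial (Nat.succ_ne_zero (r + 1))]

lemma expPoly_zero : expPoly P k₁ k₂ 0 = 1 := by simp [expPoly]

lemma constantCoeff_expPoly {j : ℕ} (hj : j ≠ 0) :
    MvPolynomial.constantCoeff (expPoly P k₁ k₂ j) = 0 := by
  rw [expPoly, map_sum]
  refine Finset.sum_eq_zero fun s _ => ?_
  rw [map_mul, ← PowerSeries.coeff_map, map_pow]
  have : PowerSeries.map MvPolynomial.constantCoeff (PowerSeries.mk (exponentPoly P k₁ k₂)) =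
      0 := by
    ext r
    simp [constantCoeff_exponentPoly]
  rw [this]
  rcases Nat.eq_zero_or_pos s with rfl | hs
  · simp [PowerSeries.coeff_one, hj]
  · simp [hs.ne']

variable {P k₁ k₂}

lemma ampSpectrum_eq_zero {N : ℕ} {g : Fin N → Amplitude}
    (h : ∑ j, signedMode k₁ k₂ (g j) ≠ 0) : ampSpectrum P k₁ k₂ g = 0 := by
  simp [ampSpectrum, normPolyspectrum, h]

variable {n m : ℕ}

lemma Resonance.exponentPoly_mem_range (h : Resonance k₁ k₂ n m) {r : ℕ} (hr : r + 2 < n + m) :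
    exponentPoly P k₁ k₂ r ∈ intensityMap.range := by
  rw [exponentPoly]
  split_ifs with h0
  · exact Subalgebra.zero_mem _
  · refine Subalgebra.mul_mem _ (intensityMap.range.algebraMap_mem _)
      (Subalgebra.sum_mem _ fun g _ => ?_)
    by_cases hg : ∑ j, signedMode k₁ k₂ (g j) = 0
    · refine Subalgebra.mul_mem _ (intensityMap.range.algebraMap_mem _)
        (tupleMonomial_mem_range ?_)
      rcases h.mult_cases hg hr.le with hb | hb
      · exact hb
      · omega
    · rw [ampSpectrum_eq_zero hg, map_zero, zero_mul]
      exact Subalgebra.zero_mem _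

/-- The powers of the exponent from the second one on involve only the intensities up to the
order of the first resonance. -/
lemma Resonance.coeff_pow_mem_range (h : Resonance k₁ k₂ n m) {j s : ℕ} (hj : j + 2 ≤ n + m)
    (hs : s ≠ 1 ∨ j + 2 < n + m) :
    PowerSeries.coeff j (PowerSeries.mk (exponentPoly P k₁ k₂) ^ s) ∈ intensityMap.range := by
  rw [PowerSeries.coeff_pow]
  refine Subalgebra.sum_mem _ fun l hl => ?_
  rw [Finset.mem_finsuppAntidiag] at hl
  -- The exponent has no constant term, so only compositions of `j` into positive parts contribute.
  by_cases hz : ∃ i ∈ Finset.range s, l i = 0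
  · obtain ⟨i, hi, h0⟩ := hz
    rw [Finset.prod_eq_zero hi (by simp [h0, exponentPoly])]
    exact Subalgebra.zero_mem _
  · push Not at hz
    refine Subalgebra.prod_mem _ fun i hi => ?_
    rw [PowerSeries.coeff_mk]
    refine h.exponentPoly_mem_range ?_
    have h1 := Finset.add_sum_erase _ (fun i => l i) hi
    rw [hl.1] at h1
    rcases hs with hs | hs
    -- With a second positive part present, each part is strictly smaller than `j` and stays below
    -- the resonant order.
    · have h2 : ((Finset.range s).erase i).Nonempty := by
        rw [← Finset.card_pos, Finset.card_erase_of_mem hi, Finset.card_range]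
        have := Finset.mem_range.1 hi
        omega
      have h3 : 0 < ∑ x ∈ (Finset.range s).erase i, l x :=
        Finset.sum_pos (fun x hx => Nat.pos_of_ne_zero (hz x (Finset.mem_of_mem_erase hx))) h2
      omega
    · omega

lemma Resonance.phaseFunctional_expPoly_of_lt (h : Resonance k₁ k₂ n m) {j : ℕ} (hj0 : j ≠ 0)
    (hj : j + 2 < n + m) (θ : ℝ × ℝ) : phaseFunctional θ (expPoly P k₁ k₂ j) = 0 := by
  rw [phaseFunctional_of_mem_range, constantCoeff_expPoly P k₁ k₂ hj0]
  exact Subalgebra.sum_mem _ fun s _ => Subalgebra.mul_mem _ (intensityMap.range.algebraMap_mem _)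
    (h.coeff_pow_mem_range hj.le (Or.inr hj))

/-- At the resonant order the terms nonlinear in the exponent are polynomials in the intensities
without constant term, so they drop out. -/
lemma Resonance.phaseFunctional_expPoly_eq (h : Resonance k₁ k₂ n m) {j : ℕ}
    (hj : j + 2 = n + m) (θ : ℝ × ℝ) :
    phaseFunctional θ (expPoly P k₁ k₂ j) = phaseFunctional θ (exponentPoly P k₁ k₂ j) := by
  have hj0 : j ≠ 0 := by have := h.two_lt; omega
  have hmem : expPoly P k₁ k₂ j - exponentPoly P k₁ k₂ j ∈ intensityMap.range := by
    rw [expPoly, ← Finset.add_sum_erase _ _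
      (Finset.mem_range.2 (show 1 < j + 1 by omega))]
    simp only [Nat.factorial_one, Nat.cast_one, inv_one, map_one, one_mul, pow_one,
      PowerSeries.coeff_mk, add_sub_cancel_left]
    exact Subalgebra.sum_mem _ fun s hs => Subalgebra.mul_mem _
      (intensityMap.range.algebraMap_mem _)
      (h.coeff_pow_mem_range hj.le (Or.inl (Finset.ne_of_mem_erase hs)))
  have := phaseFunctional_of_mem_range hmem θ
  rwa [map_sub, map_sub, constantCoeff_expPoly P k₁ k₂ hj0, constantCoeff_exponentPoly, sub_zero,
    sub_eq_zero] at this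

lemma phaseFunctional_exponentPoly {N r : ℕ} (hr : r ≠ 0) (hN : r + 2 = N) (θ : ℝ × ℝ) :
    phaseFunctional θ (exponentPoly P k₁ k₂ r) = (-Complex.I) ^ N / (N ! : ℂ) *
      ∑ g : Fin N → Amplitude, ampSpectrum P k₁ k₂ g * phaseFunctional θ (tupleMonomial g) := by
  subst hN
  rw [exponentPoly, if_neg hr, ← MvPolynomial.smul_eq_C_mul, map_smul, smul_eq_mul, map_sum]
  simp_rw [← MvPolynomial.smul_eq_C_mul, map_smul, smul_eq_mul]

/-- The resonant contribution to the phase distribution. -/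
lemma Resonance.sum_ampSpectrum (h : Resonance k₁ k₂ n m) {q : ℂ}
    (hq₁ : ∀ g ∈ twoTypeTuples (n + m) n m (true, true) (false, false),
      ampSpectrum P k₁ k₂ g = q)
    (hq₂ : ∀ g ∈ twoTypeTuples (n + m) n m (true, false) (false, true),
      ampSpectrum P k₁ k₂ g = q) (θ : ℝ × ℝ) :
    ∑ g : Fin (n + m) → Amplitude, ampSpectrum P k₁ k₂ g * phaseFunctional θ (tupleMonomial g) =
      (n + m).choose n * q * (radialMoment n 0 θ.1 * radialMoment 0 m θ.2 +
        radialMoment 0 n θ.1 * radialMoment m 0 θ.2) := by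
  set S₁ := twoTypeTuples (n + m) n m (true, true) (false, false) with hS₁
  set S₂ := twoTypeTuples (n + m) n m (true, false) (false, true) with hS₂
  have h1 : ∀ g ∈ S₁, ampSpectrum P k₁ k₂ g * phaseFunctional θ (tupleMonomial g) =
      q * (radialMoment n 0 θ.1 * radialMoment 0 m θ.2) := by
    intro g hg
    rw [hq₁ g hg, phaseFunctional_tupleMonomial,
      mult_eq_zero_of_mem (by decide) rfl hg (c'' := (true, false)) (by decide) (by decide),
      mult_eq_zero_of_mem (by decide) rfl hg (c'' := (false, true)) (by decide) (by decide),
      (mem_twoTypeTuples.1 hg).1, (mem_twoTypeTuples.1 hg).2]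
  have h2 : ∀ g ∈ S₂, ampSpectrum P k₁ k₂ g * phaseFunctional θ (tupleMonomial g) =
      q * (radialMoment 0 n θ.1 * radialMoment m 0 θ.2) := by
    intro g hg
    rw [hq₂ g hg, phaseFunctional_tupleMonomial,
      mult_eq_zero_of_mem (by decide) rfl hg (c'' := (true, true)) (by decide) (by decide),
      mult_eq_zero_of_mem (by decide) rfl hg (c'' := (false, false)) (by decide) (by decide),
      (mem_twoTypeTuples.1 hg).1, (mem_twoTypeTuples.1 hg).2]
  have hdisj : Disjoint S₁ S₂ := by
    refine Finset.disjoint_left.2 fun g hg hg' => ?_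
    have := mult_eq_zero_of_mem (by decide) rfl hg (c'' := (true, false)) (by decide) (by decide)
    rw [(mem_twoTypeTuples.1 hg').1] at this
    exact h.pos_left.ne' this
  -- Outside the two resonant families either the polyspectrum vanishes because the sum of
  -- wavevectors is non-zero, or the tuple is balanced and carries no phase dependence.
  have h3 : ∀ g ∈ Finset.univ, g ∉ S₁ ∪ S₂ →
      ampSpectrum P k₁ k₂ g * phaseFunctional θ (tupleMonomial g) = 0 := by
    intro g _ hg
    by_cases hs : ∑ j, signedMode k₁ k₂ (g j) = 0
    · rcases h.mult_cases hs le_rfl with hb | ⟨-, hb⟩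
      · rw [phaseFunctional_of_mem_range (tupleMonomial_mem_range hb), constantCoeff_tupleMonomial,
          mul_zero]
        have := h.two_lt
        omega
      · exact absurd (Finset.mem_union.2 hb) hg
    · rw [ampSpectrum_eq_zero hs, zero_mul]
  rw [← Finset.sum_subset (Finset.subset_univ _) h3, Finset.sum_union hdisj,
    Finset.sum_congr rfl h1, Finset.sum_congr rfl h2, Finset.sum_const, Finset.sum_const,
    card_twoTypeTuples (by decide) rfl, card_twoTypeTuples (by decide) rfl]
  simp only [nsmul_eq_mul]
  ring

/-- The two families carry opposite phases and combine to a cosine. The factor `I ^ (n + m)` later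
cancels the `(-I) ^ (n + m)` of the cumulant expansion. -/
lemma radialMoment_resonant (n m : ℕ) (θ : ℝ × ℝ) :
    radialMoment n 0 θ.1 * radialMoment 0 m θ.2 + radialMoment 0 n θ.1 * radialMoment m 0 θ.2 =
      Complex.I ^ (n + m) * (2 * Real.Gamma (1 + n / 2) * Real.Gamma (1 + m / 2) *
        Real.cos (n * θ.1 - m * θ.2) : ℝ) := by
  simp only [radialMoment_zero_left, radialMoment_zero_right, ← Complex.exp_nat_mul]
  push_cast
  rw [Complex.cos]
  have h1 : Complex.exp ((n : ℂ) * (-(Complex.I * θ.1))) * Complex.exp (m * (Complex.I * θ.2)) =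
      Complex.exp (-(n * θ.1 - m * θ.2) * Complex.I) := by
    rw [← Complex.exp_add]; congr 1; ring
  have h2 : Complex.exp ((n : ℂ) * (Complex.I * θ.1)) * Complex.exp (m * (-(Complex.I * θ.2))) =
      Complex.exp ((n * θ.1 - m * θ.2) * Complex.I) := by
    rw [← Complex.exp_add]; congr 1; ring
  rw [← h1, ← h2, pow_add]
  ring

lemma Resonance.phaseFunctional_leading (h : Resonance k₁ k₂ n m) {q : ℂ}
    (hq₁ : ∀ g ∈ twoTypeTuples (n + m) n m (true, true) (false, false),
      ampSpectrum P k₁ k₂ g = q)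
    (hq₂ : ∀ g ∈ twoTypeTuples (n + m) n m (true, false) (false, true),
      ampSpectrum P k₁ k₂ g = q) {j : ℕ} (hj : j + 2 = n + m) (θ : ℝ × ℝ) :
    phaseFunctional θ (expPoly P k₁ k₂ j) =
      ((2 / ((n ! : ℝ) * (m ! : ℝ)) * Real.Gamma (1 + (n : ℝ) / 2) *
        Real.Gamma (1 + (m : ℝ) / 2) * Real.cos (n * θ.1 - m * θ.2) : ℝ) : ℂ) * q := by
  have hj0 : j ≠ 0 := by have := h.two_lt; omega
  rw [h.phaseFunctional_expPoly_eq hj, phaseFunctional_exponentPoly hj0 hj,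
    h.sum_ampSpectrum hq₁ hq₂, radialMoment_resonant, Nat.choose_symm_add, Nat.add_choose,
    Nat.cast_div
      (Nat.factorial_mul_factorial_dvd_factorial_add n m)
      (by exact_mod_cast (Nat.mul_pos n.factorial_pos m.factorial_pos).ne')]
  have hI : (-Complex.I) ^ (n + m) * Complex.I ^ (n + m) = 1 := by
    rw [← mul_pow]; simp
  have h1 : ((n + m)! : ℂ) ≠ 0 := by exact_mod_cast (n + m).factorial_ne_zero
  have h2 : (n ! : ℂ) ≠ 0 := by exact_mod_cast n.factorial_ne_zero
  have h3 : (m ! : ℂ) ≠ 0 := by exact_mod_cast m.factorial_ne_zero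
  push_cast
  generalize (Real.Gamma (1 + n / 2) : ℂ) = G
  generalize (Real.Gamma (1 + m / 2) : ℂ) = G'
  field_simp
  linear_combination (q * G * G' * Complex.cos (n * θ.1 - m * θ.2)) * hI

end Expansion

/-! ### Two modes of a homogeneous field -/

/-- A homogeneous field whose polyspectra at the two modes are given by `P`. -/
structure TwoModeField {d : ℕ} {Ω : Type*} [MeasurableSpace Ω] (μ : Measure Ω) (L : Fin d → ℝ)
    (f : Ω → (Fin d → ℝ) → ℝ) (P : Polyspectra d) (k₁ k₂ : Fin d → ℝ) : Prop where
  side_pos : ∀ j, 0 < L j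
  field : IsHomogeneousField μ L f
  wavevector_left : IsWavevector L k₁
  wavevector_right : IsWavevector L k₂
  polyspectrum_eq : ∀ N, 2 ≤ N → ∀ k : Fin N → Fin d → ℝ, FromModes k₁ k₂ k →
    polyspectrum μ L f N k = P N k
  symm : ∀ N, 2 ≤ N → ∀ k : Fin N → Fin d → ℝ, FromModes k₁ k₂ k → P N (fun j => -k j) = P N k
  pos_left : 0 < powerSpectrum P k₁
  pos_right : 0 < powerSpectrum P k₂

/-- The amplitude with the opposite wavevector. -/
def flip (c : Amplitude) : Amplitude := (c.1, !c.2)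

lemma signedMode_flip {d : ℕ} (k₁ k₂ : Fin d → ℝ) (c : Amplitude) :
    signedMode k₁ k₂ (flip c) = -signedMode k₁ k₂ c := by
  rcases c with ⟨_ | _, _ | _⟩ <;> simp [flip, signedMode]

lemma fromModes_signedMode {d N : ℕ} (k₁ k₂ : Fin d → ℝ) (g : Fin N → Amplitude) :
    FromModes k₁ k₂ fun j => signedMode k₁ k₂ (g j) := by
  intro j
  rcases hc : g j with ⟨_ | _, _ | _⟩ <;> simp [signedMode, hc]

/-- The four amplitudes as random variables. -/
def ampVar {d : ℕ} {Ω : Type*} (P : Polyspectra d) (L : Fin d → ℝ)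
    (f : Ω → (Fin d → ℝ) → ℝ) (k₁ k₂ : Fin d → ℝ) (c : Amplitude) (ω : Ω) : ℂ :=
  (Real.sqrt (powerSpectrum P (signedMode k₁ k₂ c)) : ℂ)⁻¹ * mode L f (signedMode k₁ k₂ c) ω

namespace TwoModeField

variable {d : ℕ} {Ω : Type*} [MeasurableSpace Ω] {μ : Measure Ω}
  {L : Fin d → ℝ} {f : Ω → (Fin d → ℝ) → ℝ} {P : Polyspectra d} {k₁ k₂ : Fin d → ℝ}

lemma isWavevector (h : TwoModeField μ L f P k₁ k₂) (c : Amplitude) :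
    IsWavevector L (signedMode k₁ k₂ c) := by
  have hneg : ∀ k : Fin d → ℝ, IsWavevector L k → IsWavevector L (-k) := fun k hk j => by
    obtain ⟨z, hz⟩ := hk j
    exact ⟨-z, by rw [Pi.neg_apply, hz]; push_cast; ring⟩
  rcases c with ⟨_ | _, _ | _⟩
  exacts [hneg _ h.wavevector_right, h.wavevector_right, hneg _ h.wavevector_left,
    h.wavevector_left]

lemma pair_eq (h : TwoModeField μ L f P k₁ k₂) (c : Amplitude) :
    P 2 ![signedMode k₁ k₂ (flip c), signedMode k₁ k₂ c] =
      P 2 ![signedMode k₁ k₂ c, signedMode k₁ k₂ (flip c)] := by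
  have hF := fromModes_signedMode k₁ k₂ ![c, flip c]
  have := h.symm 2 le_rfl _ hF
  have e1 : (fun j => -signedMode k₁ k₂ (![c, flip c] j)) =
      ![signedMode k₁ k₂ (flip c), signedMode k₁ k₂ c] := by
    ext j : 1; fin_cases j <;> simp [signedMode_flip]
  have e2 : (fun j => signedMode k₁ k₂ (![c, flip c] j)) =
      ![signedMode k₁ k₂ c, signedMode k₁ k₂ (flip c)] := by
    ext j : 1; fin_cases j <;> simp
  rwa [e1, e2] at this

lemma powerSpectrum_flip (h : TwoModeField μ L f P k₁ k₂) (c : Amplitude) :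
    powerSpectrum P (signedMode k₁ k₂ (flip c)) = powerSpectrum P (signedMode k₁ k₂ c) := by
  have := h.pair_eq c
  rw [powerSpectrum, powerSpectrum, ← signedMode_flip k₁ k₂ c, ← this, signedMode_flip, neg_neg]

lemma powerSpectrum_pos (h : TwoModeField μ L f P k₁ k₂) (c : Amplitude) :
    0 < powerSpectrum P (signedMode k₁ k₂ c) := by
  rcases c with ⟨_ | _, _ | _⟩
  · exact (h.powerSpectrum_flip (false, true)).symm ▸ h.pos_right
  · exact h.pos_right
  · exact (h.powerSpectrum_flip (true, true)).symm ▸ h.pos_left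
  · exact h.pos_left

/-- The power spectrum is the polyspectrum of order `2`, which is real. -/
lemma pair_eq_powerSpectrum (h : TwoModeField μ L f P k₁ k₂) (c : Amplitude) :
    P 2 ![signedMode k₁ k₂ c, signedMode k₁ k₂ (flip c)] =
      (powerSpectrum P (signedMode k₁ k₂ c) : ℂ) := by
  have h1 : ∀ c, P 2 ![signedMode k₁ k₂ c, signedMode k₁ k₂ (flip c)] =
      ((vol L ^ (((2 : ℕ) : ℝ) / 2 - 1) : ℝ) : ℂ) * jointCumulant μ
        fun j => mode L f (![signedMode k₁ k₂ c, signedMode k₁ k₂ (flip c)] j) := by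
    intro c
    rw [← h.polyspectrum_eq 2 le_rfl]
    · rfl
    · have := fromModes_signedMode k₁ k₂ ![c, flip c]
      intro j
      have := this j
      fin_cases j <;> exact this
  -- Conjugating a mode of a real field reverses its wavevector. Together with the symmetry under `k
  -- ↦ -k`, this makes the pair value real.
  have h2 : conj (P 2 ![signedMode k₁ k₂ c, signedMode k₁ k₂ (flip c)]) =
      P 2 ![signedMode k₁ k₂ (flip c), signedMode k₁ k₂ c] := by
    have hff : flip (flip c) = c := by simp [flip]
    have := h1 (flip c)
    rw [hff] at this
    rw [this, h1, map_mul, Complex.conj_ofReal, ← jointCumulant_conj]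
    congr 2
    ext j ω
    rw [conj_mode]
    congr 1
    fin_cases j <;> simp [signedMode_flip]
  rw [h.pair_eq] at h2
  rw [powerSpectrum, ← signedMode_flip]
  exact (Complex.conj_eq_iff_re.1 h2).symm

/-- The symmetry of `P` in its arguments is inherited from the cumulants of the field. -/
lemma ampSpectrum_perm (h : TwoModeField μ L f P k₁ k₂) {N : ℕ} (hN : 2 ≤ N)
    (g : Fin N → Amplitude) (σ : Equiv.Perm (Fin N)) :
    ampSpectrum P k₁ k₂ (g ∘ σ) = ampSpectrum P k₁ k₂ g := by
  have h1 : P N (fun j => signedMode k₁ k₂ ((g ∘ σ) j)) = P N fun j => signedMode k₁ k₂ (g j) := by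
    rw [← h.polyspectrum_eq N hN _ (fromModes_signedMode k₁ k₂ _),
      ← h.polyspectrum_eq N hN _ (fromModes_signedMode k₁ k₂ _), polyspectrum, polyspectrum]
    congr 1
    exact jointCumulant_comp_perm (fun j => mode L f (signedMode k₁ k₂ (g j))) σ
  rw [ampSpectrum, ampSpectrum, normPolyspectrum, normPolyspectrum, h1]
  simp only [Function.comp_apply]
  rw [Equiv.sum_comp σ fun j => signedMode k₁ k₂ (g j),
    Equiv.prod_comp σ fun j => powerSpectrum P (signedMode k₁ k₂ (g j))]

/-- Reflection symmetry gives the two resonant families the same coefficient, so that no sine term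
appears. -/
lemma ampSpectrum_flip (h : TwoModeField μ L f P k₁ k₂) {N : ℕ} (hN : 2 ≤ N)
    (g : Fin N → Amplitude) :
    ampSpectrum P k₁ k₂ (fun j => flip (g j)) = ampSpectrum P k₁ k₂ g := by
  rw [ampSpectrum, ampSpectrum, normPolyspectrum, normPolyspectrum]
  simp_rw [h.powerSpectrum_flip, signedMode_flip, Finset.sum_neg_distrib, neg_eq_zero]
  rw [h.symm N hN _ (fromModes_signedMode k₁ k₂ g)]

lemma pairing_eq_sum (h : TwoModeField μ L f P k₁ k₂) (w : ℂ × ℂ) (ω : Ω) :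
    (pairing w (alpha P L f k₁ ω, alpha P L f k₂ ω) : ℂ) =
      ∑ c, coord w c * ampVar P L f k₁ k₂ c ω := by
  have e1 := h.powerSpectrum_flip (true, true)
  have e2 := h.powerSpectrum_flip (false, true)
  simp only [flip, Bool.not_true] at e1 e2
  rw [sum_amplitude, ofReal_pairing]
  simp only [ampVar, e1, e2]
  simp only [coord, signedMode, alpha, map_div₀, Complex.conj_ofReal, conj_mode]
  ring

lemma ampSpectrum_pair (h : TwoModeField μ L f P k₁ k₂) (c : Amplitude) :
    ampSpectrum P k₁ k₂ ![c, flip c] = 1 := by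
  have hpos := h.powerSpectrum_pos c
  have e2 : (fun j => signedMode k₁ k₂ (![c, flip c] j)) =
      ![signedMode k₁ k₂ c, signedMode k₁ k₂ (flip c)] := by
    ext j : 1; fin_cases j <;> simp
  rw [ampSpectrum, e2, normPolyspectrum, if_pos (by simp [signedMode_flip]),
    h.pair_eq_powerSpectrum]
  simp only [Fin.prod_univ_two, Matrix.cons_val_zero, Matrix.cons_val_one, h.powerSpectrum_flip]
  rw [Real.sqrt_mul_self hpos.le]
  exact div_self (by exact_mod_cast hpos.ne')

variable {n m : ℕ}

lemma leading_eq (h : TwoModeField μ L f P k₁ k₂) (hR : Resonance k₁ k₂ n m) (θ : ℝ × ℝ) {j : ℕ}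
    (hj : j + 2 = n + m) :
    phaseFunctional θ (expPoly P k₁ k₂ j) = leading P k₁ k₂ n m θ := by
  have hN : 2 ≤ n + m := hR.two_lt.le
  set g₁ : Fin (n + m) → Amplitude :=
    Fin.append (fun _ : Fin n => (true, true)) (fun _ : Fin m => (false, false)) with hg₁
  set g₂ : Fin (n + m) → Amplitude :=
    Fin.append (fun _ : Fin n => (true, false)) (fun _ : Fin m => (false, true)) with hg₂
  have hm₁ := append_mem_twoTypeTuples n m (c := (true, true)) (c' := (false, false)) (by decide)
  have hm₂ := append_mem_twoTypeTuples n m (c := (true, false)) (c' := (false, true)) (by decide)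
  have hflip : g₂ = fun j => flip (g₁ j) := by
    ext1 j
    refine Fin.addCases (fun i => ?_) (fun i => ?_) j <;> simp [hg₁, hg₂, flip]
  have happ : (fun j => signedMode k₁ k₂ (g₁ j)) =
      Fin.append (fun _ : Fin n => k₁) (fun _ : Fin m => -k₂) := by
    ext1 j
    refine Fin.addCases (fun i => ?_) (fun i => ?_) j <;> simp [hg₁, signedMode]
  have hq₁ : ∀ g ∈ twoTypeTuples (n + m) n m (true, true) (false, false),
      ampSpectrum P k₁ k₂ g = ampSpectrum P k₁ k₂ g₁ := by
    intro g hg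
    obtain ⟨σ, rfl⟩ := exists_perm_of_mult_eq
      (mult_eq_mult_of_mem_twoTypeTuples (by decide) rfl hg hm₁)
    exact h.ampSpectrum_perm hN _ σ
  have hq₂ : ∀ g ∈ twoTypeTuples (n + m) n m (true, false) (false, true),
      ampSpectrum P k₁ k₂ g = ampSpectrum P k₁ k₂ g₁ := by
    intro g hg
    obtain ⟨σ, rfl⟩ := exists_perm_of_mult_eq
      (mult_eq_mult_of_mem_twoTypeTuples (by decide) rfl hg hm₂)
    rw [h.ampSpectrum_perm hN _ σ, ← hg₂, hflip, h.ampSpectrum_flip hN]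
  rw [hR.phaseFunctional_leading hq₁ hq₂ hj, leading, ampSpectrum, happ]

variable [IsProbabilityMeasure μ]

lemma ampVar_mem_momentAlgebra (h : TwoModeField μ L f P k₁ k₂) (c : Amplitude) :
    ampVar P L f k₁ k₂ c ∈ momentAlgebra μ :=
  (momentAlgebra μ).smul_mem (mode_mem_momentAlgebra h.field _) _

/-- The scaled cumulants of the amplitudes are the normalized polyspectra. -/
lemma vol_mul_jointCumulant (h : TwoModeField μ L f P k₁ k₂) (r : ℕ)
    (g : Fin (r + 2) → Amplitude) :
    ((vol L ^ ((r : ℝ) / 2) : ℝ) : ℂ) * jointCumulant μ (fun j => ampVar P L f k₁ k₂ (g j)) =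
      ampSpectrum P k₁ k₂ g := by
  have h1 : jointCumulant μ (fun j => ampVar P L f k₁ k₂ (g j)) =
      (∏ j, (Real.sqrt (powerSpectrum P (signedMode k₁ k₂ (g j))) : ℂ)⁻¹) *
        jointCumulant μ fun j => mode L f (signedMode k₁ k₂ (g j)) :=
    jointCumulant_mul_left (fun j => mode_mem_momentAlgebra h.field _) _
  rw [h1, ampSpectrum, normPolyspectrum]
  split_ifs with hs
  · rw [← h.polyspectrum_eq _ (by omega) _ (fromModes_signedMode k₁ k₂ g), polyspectrum,
      Finset.prod_inv_distrib, ← Complex.ofReal_prod,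
      ← Real.sqrt_prod _ fun j _ => (h.powerSpectrum_pos (g j)).le]
    have : (((r + 2 : ℕ) : ℝ) / 2 - 1) = (r : ℝ) / 2 := by push_cast; ring
    rw [this]
    ring
  · rw [jointCumulant_mode_eq_zero h.side_pos h.field (fun j => h.isWavevector _) hs]
    simp

lemma vol_mul_cumulantX (h : TwoModeField μ L f P k₁ k₂) (r : ℕ) (w : ℂ × ℂ) :
    ((vol L ^ ((r : ℝ) / 2) : ℝ) : ℂ) *
      cumulantX μ (fun ω => (alpha P L f k₁ ω, alpha P L f k₂ ω)) (r + 2) w =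
      ∑ g : Fin (r + 2) → Amplitude, (∏ j, coord w (g j)) * ampSpectrum P k₁ k₂ g := by
  have h1 := jointCumulant_sum_mul (N := r + 2) h.ampVar_mem_momentAlgebra fun _ => coord w
  simp_rw [← h.pairing_eq_sum] at h1
  rw [cumulantX, h1, Finset.mul_sum]
  refine Finset.sum_congr rfl fun g _ => ?_
  rw [← h.vol_mul_jointCumulant]
  ring

lemma exponentSeries_eq (h : TwoModeField μ L f P k₁ k₂) (w : ℂ × ℂ) :
    exponentSeries μ (vol L) (fun ω => (alpha P L f k₁ ω, alpha P L f k₂ ω)) w =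
      PowerSeries.map (MvPolynomial.eval (coord w)) (PowerSeries.mk (exponentPoly P k₁ k₂)) := by
  ext r
  rw [exponentSeries, PowerSeries.coeff_map, PowerSeries.coeff_mk, PowerSeries.coeff_mk,
    exponentPoly]
  split_ifs with hr
  · simp
  · rw [h.vol_mul_cumulantX, map_mul, MvPolynomial.eval_C, map_sum]
    congr 1
    refine Finset.sum_congr rfl fun g _ => ?_
    rw [map_mul, MvPolynomial.eval_C, tupleMonomial, map_prod, mul_comm]
    simp

lemma expCoeff_eq (h : TwoModeField μ L f P k₁ k₂) (j : ℕ) (w : ℂ × ℂ) :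
    expCoeff μ (vol L) (fun ω => (alpha P L f k₁ ω, alpha P L f k₂ ω)) j w =
      MvPolynomial.eval (coord w) (expPoly P k₁ k₂ j) := by
  rw [expCoeff, expPoly, map_sum]
  refine Finset.sum_congr rfl fun s _ => ?_
  rw [h.exponentSeries_eq, ← map_pow, PowerSeries.coeff_map, map_mul, MvPolynomial.eval_C]

/-- The quadratic cumulant. -/
lemma cumulantX_two (h : TwoModeField μ L f P k₁ k₂) (hR : Resonance k₁ k₂ n m) (w : ℂ × ℂ) :
    cumulantX μ (fun ω => (alpha P L f k₁ ω, alpha P L f k₂ ω)) 2 w =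
      ((‖w.1‖ : ℂ) ^ 2 + (‖w.2‖ : ℂ) ^ 2) / 2 := by
  have h1 := h.vol_mul_cumulantX 0 w
  simp only [Nat.cast_zero, zero_div, Real.rpow_zero, Complex.ofReal_one, one_mul, zero_add] at h1
  rw [h1, ← Equiv.sum_comp (finTwoArrowEquiv Amplitude).symm, Fintype.sum_prod_type]
  have h2 : ∀ c : Amplitude, ∑ c' : Amplitude,
      (∏ j, coord w ((finTwoArrowEquiv Amplitude).symm (c, c') j)) *
        ampSpectrum P k₁ k₂ ((finTwoArrowEquiv Amplitude).symm (c, c')) =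
      coord w c * coord w (flip c) := by
    intro c
    rw [Finset.sum_eq_single (flip c)]
    · simp only [finTwoArrowEquiv_symm_apply]
      rw [h.ampSpectrum_pair, Fin.prod_univ_two]
      simp
    · intro c' _ hc'
      simp only [finTwoArrowEquiv_symm_apply]
      -- A finite check: a pair of amplitudes can be balanced only if they are opposite. The
      -- resonant alternatives are excluded by `2 < n + m`.
      have hnb : ∀ c c' : Amplitude, c' ≠ flip c → ¬ IsBalanced ![c, c'] := by
        unfold IsBalanced mult flip
        decide
      rw [ampSpectrum_eq_zero, mul_zero]
      intro hs
      have := hR.two_lt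
      rcases hR.mult_cases hs this.le with hb | hb
      · exact hnb c c' hc' hb
      · omega
    · simp
  simp_rw [h2]
  rw [sum_amplitude]
  simp only [coord, flip, Bool.not_true, Bool.not_false]
  rw [← Complex.mul_conj', ← Complex.mul_conj']
  ring

lemma densityCoeff_eq (h : TwoModeField μ L f P k₁ k₂) (hR : Resonance k₁ k₂ n m) (j : ℕ) :
    densityCoeff μ (vol L) (fun ω => (alpha P L f k₁ ω, alpha P L f k₂ ω)) j =
      gaussTransform (expPoly P k₁ k₂ j) := by
  ext z
  rw [densityCoeff, gaussTransform]
  simp_rw [h.cumulantX_two hR, h.expCoeff_eq]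
  rfl

lemma coeff_corrSeries (h : TwoModeField μ L f P k₁ k₂) (hR : Resonance k₁ k₂ n m) (θ : ℝ × ℝ)
    (j : ℕ) : PowerSeries.coeff j
      (corrSeries μ (vol L) (fun ω => (alpha P L f k₁ ω, alpha P L f k₂ ω)) θ) =
      phaseFunctional θ (expPoly P k₁ k₂ j) - if j = 0 then 1 else 0 := by
  rw [corrSeries, map_sub, PowerSeries.coeff_mk, PowerSeries.coeff_one, h.densityCoeff_eq hR,
    integrateModuli_gaussTransform]

/-- All the coefficients of the correlation series up to the first resonance. -/
lemma coeff_corrSeries_of_le (h : TwoModeField μ L f P k₁ k₂) (hR : Resonance k₁ k₂ n m)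
    (θ : ℝ × ℝ) {j : ℕ} (hj : j ≤ n + m - 2) : PowerSeries.coeff j
      (corrSeries μ (vol L) (fun ω => (alpha P L f k₁ ω, alpha P L f k₂ ω)) θ) =
      if j = n + m - 2 then leading P k₁ k₂ n m θ else 0 := by
  have h2 := hR.two_lt
  rw [h.coeff_corrSeries hR]
  rcases Nat.eq_zero_or_pos j with rfl | hj0
  · rw [expPoly_zero, phaseFunctional_of_mem_range (Subalgebra.one_mem _), map_one, if_pos rfl,
      if_neg (by omega), sub_self]
  · rw [if_neg hj0.ne', sub_zero]
    split_ifs with hj'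
    · exact h.leading_eq hR θ (by omega)
    · exact hR.phaseFunctional_expPoly_of_lt hj0.ne' (by omega) θ

end TwoModeField

/-! ### Error estimates -/

lemma integrableOn_moduli_weight : IntegrableOn
    (fun A : ℝ × ℝ => (1 + ‖A.1‖) ^ (-(3 / 2) : ℝ) * (1 + ‖A.2‖) ^ (-(3 / 2) : ℝ)) moduli := by
  have h : IntegrableOn (fun x : ℝ => (1 + ‖x‖) ^ (-(3 / 2) : ℝ)) (Set.Ioi 0) :=
    (integrable_one_add_norm (by norm_num)).integrableOn
  rw [IntegrableOn, restrict_moduli]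
  exact h.mul_prod h

lemma norm_polar {A : ℝ × ℝ} (hA : A ∈ moduli) (θ : ℝ × ℝ) : ‖polar A θ‖ = max A.1 A.2 := by
  have h1 : (0 : ℝ) < A.1 := hA.1
  have h2 : (0 : ℝ) < A.2 := hA.2
  simp only [polar, Prod.norm_def, norm_mul, norm_exp_I_mul, Complex.norm_real, Real.norm_eq_abs,
    abs_of_pos h1, abs_of_pos h2, mul_one]

/-- The decay of order `5` is split as `5/2` for each modulus. The Jacobian costs one power of each,
and the remaining exponent `3/2 > 1` is integrable. -/
lemma mul_div_one_add_norm_polar_le {A : ℝ × ℝ} (hA : A ∈ moduli) (θ : ℝ × ℝ) :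
    A.1 * A.2 / (1 + ‖polar A θ‖) ^ 5 ≤
      (1 + ‖A.1‖) ^ (-(3 / 2) : ℝ) * (1 + ‖A.2‖) ^ (-(3 / 2) : ℝ) := by
  have h1 : (0 : ℝ) < A.1 := hA.1
  have h2 : (0 : ℝ) < A.2 := hA.2
  rw [norm_polar hA, Real.norm_of_nonneg h1.le, Real.norm_of_nonneg h2.le]
  have key : ∀ x : ℝ, 0 < x → (1 + x) ^ (-(3 / 2) : ℝ) = (1 + x) * (1 + x) ^ (-(5 / 2) : ℝ) := by
    intro x hx
    rw [← Real.rpow_one_add' (by linarith) (by norm_num)]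
    norm_num
  have hM : ∀ x : ℝ, 0 < x → x ≤ max A.1 A.2 →
      (1 + max A.1 A.2) ^ (-(5 / 2) : ℝ) ≤ (1 + x) ^ (-(5 / 2) : ℝ) := fun x hx hxM =>
    Real.rpow_le_rpow_of_nonpos (by linarith) (by linarith) (by norm_num)
  have hpos : 0 < 1 + max A.1 A.2 := by have := le_max_left A.1 A.2; linarith
  have h5 : ((1 + max A.1 A.2) ^ 5)⁻¹ =
      (1 + max A.1 A.2) ^ (-(5 / 2) : ℝ) * (1 + max A.1 A.2) ^ (-(5 / 2) : ℝ) := by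
    rw [← Real.rpow_add hpos, ← Real.rpow_natCast, ← Real.rpow_neg hpos.le]
    norm_num
  rw [key _ h1, key _ h2, div_eq_mul_inv, h5]
  calc A.1 * A.2 * ((1 + max A.1 A.2) ^ (-(5 / 2) : ℝ) * (1 + max A.1 A.2) ^ (-(5 / 2) : ℝ))
      ≤ (1 + A.1) * (1 + A.2) * ((1 + A.1) ^ (-(5 / 2) : ℝ) * (1 + A.2) ^ (-(5 / 2) : ℝ)) := by
        refine mul_le_mul ?_ (mul_le_mul (hM _ h1 (le_max_left _ _)) (hM _ h2 (le_max_right _ _))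
          (by positivity) (by positivity)) (by positivity) (by positivity)
        gcongr <;> linarith
    _ = _ := by ring

/-- A density that is close to an expansion in Gaussian transforms has a close phase
distribution. -/
lemma norm_corr_sub_le {ρ : ℂ × ℂ → ℝ} (hρ : Measurable ρ) {ι : Type*} (s : Finset ι)
    (a : ι → ℂ) (U : ι → MvPolynomial Amplitude ℂ) {ε : ℝ}
    (h : ∀ z, ‖(ρ z : ℂ) - ∑ j ∈ s, a j * gaussTransform (U j) z‖ ≤ ε / (1 + ‖z‖) ^ 5)
    (θ : ℝ × ℝ) :
    ‖(corr ρ θ : ℂ) - (∑ j ∈ s, a j * phaseFunctional θ (U j) - 1)‖ ≤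
      (2 * Real.pi) ^ 2 * (ε * ∫ A in moduli,
        (1 + ‖A.1‖) ^ (-(3 / 2) : ℝ) * (1 + ‖A.2‖) ^ (-(3 / 2) : ℝ)) := by
  have hε : 0 ≤ ε := by simpa using (norm_nonneg _).trans (h 0)
  have hUi : ∀ j ∈ s, IntegrableOn
      (fun A : ℝ × ℝ => a j * ((A.1 * A.2) • gaussTransform (U j) (polar A θ))) moduli :=
    fun j _ => (integrableOn_gaussTransform (U j) θ).const_mul _
  have hS := integrable_finsetSum s hUi
  -- Integrability of `A₁ A₂ ρ` at fixed phases is not given in advance. It follows because `D` is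
  -- dominated by the weight and the Gaussian transforms are integrable.
  set D : ℝ × ℝ → ℂ := fun A => (A.1 * A.2) • (ρ (polar A θ) : ℂ) -
    ∑ j ∈ s, a j * ((A.1 * A.2) • gaussTransform (U j) (polar A θ)) with hD
  have hDle : ∀ A ∈ moduli, ‖D A‖ ≤
      ε * ((1 + ‖A.1‖) ^ (-(3 / 2) : ℝ) * (1 + ‖A.2‖) ^ (-(3 / 2) : ℝ)) := by
    intro A hA
    have h1 : (0 : ℝ) < A.1 := hA.1
    have h2 : (0 : ℝ) < A.2 := hA.2
    have hDA : D A = (A.1 * A.2) •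
        ((ρ (polar A θ) : ℂ) - ∑ j ∈ s, a j * gaussTransform (U j) (polar A θ)) := by
      rw [smul_sub, Finset.smul_sum]
      simp only [hD, mul_smul_comm]
    rw [hDA, norm_smul, Real.norm_of_nonneg (by positivity)]
    calc A.1 * A.2 * _ ≤ A.1 * A.2 * (ε / (1 + ‖polar A θ‖) ^ 5) := by gcongr; exact h _
      _ = ε * (A.1 * A.2 / (1 + ‖polar A θ‖) ^ 5) := by ring
      _ ≤ _ := mul_le_mul_of_nonneg_left (mul_div_one_add_norm_polar_le hA θ) hε
  have hms : MeasurableSet moduli := measurableSet_Ioi.prod measurableSet_Ioi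
  have hDae : ∀ᵐ A ∂(volume.restrict moduli), ‖D A‖ ≤
      ε * ((1 + ‖A.1‖) ^ (-(3 / 2) : ℝ) * (1 + ‖A.2‖) ^ (-(3 / 2) : ℝ)) :=
    (ae_restrict_iff' hms).2 (ae_of_all _ hDle)
  have hρm : Measurable fun A : ℝ × ℝ => (A.1 * A.2) • (ρ (polar A θ) : ℂ) := by
    have : Measurable fun A : ℝ × ℝ => polar A θ := by
      unfold polar; fun_prop
    exact (measurable_fst.mul measurable_snd).smul
      (Complex.measurable_ofReal.comp (hρ.comp this))
  have hDi : IntegrableOn D moduli :=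
    (integrableOn_moduli_weight.const_mul ε).mono'
      (hρm.aestronglyMeasurable.sub hS.aestronglyMeasurable) hDae
  have hρi : IntegrableOn (fun A : ℝ × ℝ => (A.1 * A.2) • (ρ (polar A θ) : ℂ)) moduli := by
    refine (hDi.add hS).congr (ae_of_all _ fun A => ?_)
    simp [hD]
  have hcorr : (corr ρ θ : ℂ) =
      (((2 * Real.pi) ^ 2 : ℝ) : ℂ) * (∫ A in moduli, (A.1 * A.2) • (ρ (polar A θ) : ℂ)) - 1 := by
    have : ∫ A in moduli, (A.1 * A.2) • (ρ (polar A θ) : ℂ) =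
        ((integrateModuli ρ θ : ℝ) : ℂ) := by
      rw [integrateModuli, ← integral_complex_ofReal]
      simp only [Complex.real_smul, smul_eq_mul, Complex.ofReal_mul]
    rw [this, corr]
    push_cast
    rfl
  have hdiff : (corr ρ θ : ℂ) - (∑ j ∈ s, a j * phaseFunctional θ (U j) - 1) =
      (((2 * Real.pi) ^ 2 : ℝ) : ℂ) * ∫ A in moduli, D A := by
    simp only [hD]
    rw [integral_sub hρi hS, integral_finsetSum s hUi, hcorr]
    simp_rw [integral_const_mul, ← integrateModuli_gaussTransform, integrateModuli]
    rw [mul_sub, Finset.mul_sum]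
    simp_rw [mul_left_comm (a _)]
    ring
  rw [hdiff, norm_mul, Complex.norm_real, Real.norm_of_nonneg (by positivity), ← integral_const_mul]
  gcongr
  exact norm_integral_le_of_norm_le (integrableOn_moduli_weight.const_mul ε) hDae

/-- There is no error at this truncation: every coefficient except the last one is zero. -/
lemma sum_coeff_corrSeries {d : ℕ} {Ω : Type*} [MeasurableSpace Ω] {μ : Measure Ω}
    [IsProbabilityMeasure μ] {L : Fin d → ℝ} {f : Ω → (Fin d → ℝ) → ℝ} {P : Polyspectra d}
    {k₁ k₂ : Fin d → ℝ} {n m : ℕ} (h : TwoModeField μ L f P k₁ k₂) (hR : Resonance k₁ k₂ n m)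
    (θ : ℝ × ℝ) :
    ∑ j ∈ Finset.range (n + m - 1), ((vol L ^ (-(j : ℝ) / 2) : ℝ) : ℂ) * PowerSeries.coeff j
      (corrSeries μ (vol L) (fun ω => (alpha P L f k₁ ω, alpha P L f k₂ ω)) θ) =
      ((vol L ^ ((2 - (n : ℝ) - m) / 2) : ℝ) : ℂ) * leading P k₁ k₂ n m θ := by
  have h2 := hR.two_lt
  rw [Finset.sum_eq_single (n + m - 2)]
  · rw [h.coeff_corrSeries_of_le hR θ le_rfl, if_pos rfl]
    congr 4
    rw [Nat.cast_sub h2.le]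
    push_cast
    ring
  · intro j hj hne
    have := Finset.mem_range.1 hj
    rw [h.coeff_corrSeries_of_le hR θ (by omega), if_neg hne, mul_zero]
  · intro hj
    exact absurd (Finset.mem_range.2 (by omega)) hj

end FourierPhase

end

/-- The conclusion has three parts: the expansion of `C₂` as a formal series in `V^{-1/2}`, the
estimate for its partial sums of any order as `V → ∞`, and the estimate for the actual phase
correlation when the density of the two modes is given by its expansion up to an error
of the next order. -/
theorem mainTheorem9 {d : ℕ} {ι : Type*} (l : Filter ι) (L : ι → Fin d → ℝ)
    {Ω : ι → Type*} [∀ i, MeasurableSpace (Ω i)] (μ : ∀ i, Measure (Ω i))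
    [∀ i, IsProbabilityMeasure (μ i)] (f : ∀ i, Ω i → (Fin d → ℝ) → ℝ)
    (P : Polyspectra d) (k₁ k₂ : Fin d → ℝ) (n m : ℕ)
    -- homogeneous fields in boxes whose volume tends to infinity
    (hL : ∀ i j, 0 < L i j) (hV : Tendsto (fun i => vol (L i)) l atTop)
    (hf : ∀ i, IsHomogeneousField (μ i) (L i) (f i))
    -- two different modes with `n k₁ = m k₂`
    (hk₁ : ∀ i, IsWavevector (L i) k₁) (hk₂ : ∀ i, IsWavevector (L i) k₂)
    (hne₁ : k₁ ≠ 0) (hne : k₁ ≠ k₂)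
    (hn : 0 < n) (hm : 0 < m) (hnm : Nat.Coprime n m) (hk : (n : ℝ) • k₁ = (m : ℝ) • k₂)
    -- the polyspectra do not depend on the volume and are symmetric under `k ↦ -k`
    (hP : ∀ i N, 2 ≤ N → ∀ k : Fin N → Fin d → ℝ, FromModes k₁ k₂ k →
      polyspectrum (μ i) (L i) (f i) N k = P N k)
    (hsymm : ∀ N, 2 ≤ N → ∀ k : Fin N → Fin d → ℝ, FromModes k₁ k₂ k →
      P N (fun j => -k j) = P N k)
    (hP₁ : 0 < powerSpectrum P k₁) (hP₂ : 0 < powerSpectrum P k₂) :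
    let V : ι → ℝ := fun i => vol (L i)
    let Y : ∀ i, Ω i → ℂ × ℂ :=
      fun i ω => (alpha P (L i) (f i) k₁ ω, alpha P (L i) (f i) k₂ ω)
    (∀ i θ, (PowerSeries.X : PowerSeries ℂ) ^ (n + m - 1) ∣
      corrSeries (μ i) (V i) (Y i) θ -
        PowerSeries.C (leading P k₁ k₂ n m θ) * PowerSeries.X ^ (n + m - 2)) ∧
    (∀ J : ℕ, n + m - 2 ≤ J → ∃ K : ℝ, ∀ᶠ i in l, ∀ θ,
      ‖(∑ j ∈ Finset.range (J + 1), ((V i ^ (-(j : ℝ) / 2) : ℝ) : ℂ) *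
            PowerSeries.coeff j (corrSeries (μ i) (V i) (Y i) θ)) -
          ((V i ^ ((2 - (n : ℝ) - m) / 2) : ℝ) : ℂ) * leading P k₁ k₂ n m θ‖ ≤
        K * V i ^ ((1 - (n : ℝ) - m) / 2)) ∧
    (∀ ρ : ι → ℂ × ℂ → ℝ, (∀ i, IsJointDensity (μ i) (Y i) (ρ i)) →
      (∃ K : ℝ, ∀ᶠ i in l, ∀ z : ℂ × ℂ,
        ‖(ρ i z : ℂ) - ∑ j ∈ Finset.range (n + m - 1), ((V i ^ (-(j : ℝ) / 2) : ℝ) : ℂ) *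
            densityCoeff (μ i) (V i) (Y i) j z‖ ≤
          K * V i ^ ((1 - (n : ℝ) - m) / 2) / (1 + ‖z‖) ^ 5) →
      ∃ K : ℝ, ∀ᶠ i in l, ∀ θ,
        ‖(corr (ρ i) θ : ℂ) -
            ((V i ^ ((2 - (n : ℝ) - m) / 2) : ℝ) : ℂ) * leading P k₁ k₂ n m θ‖ ≤
          K * V i ^ ((1 - (n : ℝ) - m) / 2)) := by
  intro V Y
  have hR : Resonance k₁ k₂ n m := ⟨hne₁, hne, hn, hm, hnm, hk⟩
  have h : ∀ i, TwoModeField (μ i) (L i) (f i) P k₁ k₂ := fun i =>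
    ⟨hL i, hf i, hk₁ i, hk₂ i, hP i, hsymm, hP₁, hP₂⟩
  have h2 := hR.two_lt
  refine ⟨fun i θ => ?_, fun J hJ => ?_, fun ρ hρ hK => ?_⟩
  · rw [PowerSeries.X_pow_dvd_iff]
    intro j hj
    rw [map_sub, PowerSeries.coeff_C_mul_X_pow, (h i).coeff_corrSeries_of_le hR θ (by omega),
      sub_self]
  -- The polynomials `expPoly P k₁ k₂ j` involve only `P`, `k₁` and `k₂`, so these bounds are
  -- uniform in the box as well as in the phases.
  · choose K hK using fun j => exists_norm_phaseFunctional_le (expPoly P k₁ k₂ j)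
    refine ⟨∑ j ∈ Finset.Ico (n + m - 1) (J + 1), K j, ?_⟩
    -- For `V ≥ 1` the powers `V ^ (-j/2)` with `j ≥ n + m - 1` are all bounded by the first of
    -- them.
    filter_upwards [hV.eventually_ge_atTop 1] with i hi θ
    rw [← Finset.sum_range_add_sum_Ico _ (show n + m - 1 ≤ J + 1 by omega),
      sum_coeff_corrSeries (h i) hR, add_sub_cancel_left, Finset.sum_mul]
    refine (norm_sum_le _ _).trans (Finset.sum_le_sum fun j hj => ?_)
    have hj := (Finset.mem_Ico.1 hj).1
    have hj' : (n : ℝ) + m ≤ j + 1 := by exact_mod_cast (by omega : n + m ≤ j + 1)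
    rw [(h i).coeff_corrSeries hR, if_neg (by omega), sub_zero, norm_mul, Complex.norm_real,
      Real.norm_of_nonneg (Real.rpow_nonneg (vol_pos (hL i)).le _), mul_comm]
    have hnn := (norm_nonneg _).trans (hK j θ)
    exact mul_le_mul (hK j θ) (Real.rpow_le_rpow_of_exponent_le hi (by linarith))
      (Real.rpow_nonneg (vol_pos (hL i)).le _) hnn
  · obtain ⟨K, hK⟩ := hK
    refine ⟨(2 * Real.pi) ^ 2 * (K * ∫ A in moduli,
      (1 + ‖A.1‖) ^ (-(3 / 2) : ℝ) * (1 + ‖A.2‖) ^ (-(3 / 2) : ℝ)), ?_⟩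
    filter_upwards [hK] with i hi θ
    have hbound := norm_corr_sub_le (hρ i).measurable (Finset.range (n + m - 1))
      (fun j => ((V i ^ (-(j : ℝ) / 2) : ℝ) : ℂ)) (fun j => expPoly P k₁ k₂ j)
      (ε := K * V i ^ ((1 - (n : ℝ) - m) / 2)) (fun z => by
        simpa only [← (h i).densityCoeff_eq hR] using hi z) θ
    -- The `-1` in the definition of the correlation matches the correction of the coefficient of
    -- order `0`, that is, the uniform phase distribution of the Gaussian part.
    have hsum : ∑ j ∈ Finset.range (n + m - 1), ((V i ^ (-(j : ℝ) / 2) : ℝ) : ℂ) *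
        phaseFunctional θ (expPoly P k₁ k₂ j) - 1 =
        ((V i ^ ((2 - (n : ℝ) - m) / 2) : ℝ) : ℂ) * leading P k₁ k₂ n m θ := by
      rw [← sum_coeff_corrSeries (h i) hR θ]
      simp_rw [(h i).coeff_corrSeries hR, mul_sub, Finset.sum_sub_distrib]
      congr 1
      rw [Finset.sum_eq_single 0 (fun j _ hj => by simp [hj])
        (fun h0 => absurd (Finset.mem_range.2 (by omega)) h0)]
      simp
    rw [hsum] at hbound
    exact hbound.trans (le_of_eq (by ring))
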